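/- A \emph{polynomial knot} is a smooth embedding $\kappa:\mathbb{R}\to\mathbb{R}^3$ whose components are polynomials (so $\kappa$ is injective and $\kappa'(t)\neq 0$ for all $t$); its \emph{degree} is the maximum of the degrees of its components. A \emph{topological knot} is a continuous embedding of $S^1=\mathbb{R}\cup\{\infty\}$ in $S^3=\mathbb{R}^3\cup\{\infty\}$; two of them, $\alpha_0,\alpha_1$, have the same knot type if $\alpha_0=g\circ\alpha_1\circ f$ for orientation-preserving homeomorphisms $f$ of $S^1$ and $g$ of $S^3$. The \emph{superbridge number} of a topological knot $K$ is the minimum, over all knots $K'\subset\mathbb{R}^3$ of the same knot type as $K$, of the maximum, over all unit vectors $v\in\mathbb{R}^3$, of the number of local maxima of $K'$ in the direction $v$, i.e. of the function $x\mapsto\langle v,x\rangle$ on $K'$ (a connected plateau of local maximum points counts as one local maximum). The superbridge number of a polynomial knot $\kappa$ is that of its one-point compactification $\bar\kappa:S^1\to S^3$, $\bar\kappa(\infty)=\infty$. \textbf{Proposition.} If $\kappa$ is a polynomial knot of degree $d$ with superbridge number $s$, then $s$ is finite and $$s\le \tfrac12(d+1).$$ -/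

import Mathlib

open Topology Filter

/-- Euclidean space `ℝⁿ`. -/
abbrev Euc (n : ℕ) : Type := EuclideanSpace ℝ (Fin n)

/-! ## Topological knots and knot types

The circle `S¹` and the sphere `Sⁿ` are taken as the one point compactifications
`ℝ ∪ {∞}` and `ℝⁿ ∪ {∞}`, as stereographic projection identifies them. -/

/-- A topological knot: a continuous embedding of `S¹ = ℝ ∪ {∞}` in `Sⁿ = ℝⁿ ∪ {∞}`.
(The circle is compact and the sphere is Hausdorff, so that an embedding is the same as an
injective continuous map.) -/
structure TopologicalKnot (n : ℕ) where
  toMap : C(OnePoint ℝ, OnePoint (Euc n))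
  injective : Function.Injective toMap

/-- A self-homeomorphism of a sphere `ℝⁿ ∪ {∞}` preserves the orientation iff it has degree `1`,
that is (Hopf), iff it is homotopic to the identity map. -/
def IsOrientationPreserving {X : Type*} [TopologicalSpace X] (f : X ≃ₜ X) : Prop :=
  ContinuousMap.Homotopic (f : C(X, X)) (ContinuousMap.id X)

/-- Topological equivalence of knots ("same knot type"): `α₀ = g ∘ α₁ ∘ f` for
orientation-preserving homeomorphisms `f` of `S¹` and `g` of `Sⁿ`. -/
def SameKnotType {n : ℕ} (α₀ α₁ : TopologicalKnot n) : Prop :=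
  ∃ (f : OnePoint ℝ ≃ₜ OnePoint ℝ) (g : OnePoint (Euc n) ≃ₜ OnePoint (Euc n)),
    IsOrientationPreserving f ∧ IsOrientationPreserving g ∧
      ∀ p, α₀.toMap p = g (α₁.toMap (f p))

/-- A knot lying in the affine part `ℝⁿ` of the sphere `ℝⁿ ∪ {∞}`. -/
structure EuclideanKnot (n : ℕ) where
  toMap : C(OnePoint ℝ, Euc n)
  injective : Function.Injective toMap

/-- A knot in `ℝⁿ`, regarded as a knot in the sphere `ℝⁿ ∪ {∞}`. -/
def EuclideanKnot.toTopologicalKnot {n : ℕ} (K : EuclideanKnot n) : TopologicalKnot n where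
  toMap := ⟨fun p => (K.toMap p : OnePoint (Euc n)),
    OnePoint.continuous_coe.comp K.toMap.continuous⟩
  injective := OnePoint.coe_injective.comp K.injective

/-! ## Local maxima and the superbridge number -/

/-- The local maxima of a real function `h`, a plateau counting as one local maximum: the
connected components of level sets of `h` all of whose points are local maximum points of `h`. -/
def localMaxima {X : Type*} [TopologicalSpace X] (h : X → ℝ) : Set (Set X) :=
  {C | ∃ x, C = connectedComponentIn {y | h y = h x} x ∧ ∀ y ∈ C, IsLocalMax h y}

/-- The number of local maxima (possibly infinite) of the knot `K` in the direction `v`. -/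
noncomputable def EuclideanKnot.numLocalMaxima {n : ℕ} (K : EuclideanKnot n) (v : Euc n) : ℕ∞ :=
  (localMaxima fun p => inner ℝ v (K.toMap p)).encard

/-- The superbridge number of a topological knot `K` in `S³`: the minimum, over all knots `K'` in
`ℝ³` of the same knot type as `K`, of the maximum, over all directions (unit vectors) `v`, of the
number of local maxima of `K'` in the direction `v`. -/
noncomputable def superbridgeNumber (K : TopologicalKnot 3) : ℕ∞ :=
  ⨅ (K' : EuclideanKnot 3) (_ : SameKnotType K'.toTopologicalKnot K),
    ⨆ v ∈ Metric.sphere (0 : Euc 3) 1, K'.numLocalMaxima v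

/-! ## Polynomial knots -/

/-- A polynomial knot: a smooth embedding `κ : ℝ → ℝⁿ` whose components are polynomials, i.e.
`κ(s) ≠ κ(t)` for `s ≠ t`, and `κ'(t) ≠ 0` for all `t`. (An injective polynomial map is
automatically proper, hence a closed topological embedding.) -/
structure PolynomialKnot (n : ℕ) where
  coord : Fin n → Polynomial ℝ
  injective : ∀ s t : ℝ, (∀ i, (coord i).eval s = (coord i).eval t) → s = t
  immersive : ∀ t : ℝ, ∃ i, (coord i).derivative.eval t ≠ 0

namespace PolynomialKnot

variable {n : ℕ}

/-- The map `ℝ → ℝⁿ` given by a polynomial knot. -/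
noncomputable def toFun (κ : PolynomialKnot n) (t : ℝ) : Euc n :=
  WithLp.toLp 2 fun i => (κ.coord i).eval t

/-- The degree of a polynomial knot: the maximum of the degrees of its components. -/
noncomputable def degree (κ : PolynomialKnot n) : ℕ :=
  Finset.univ.sup fun i => (κ.coord i).natDegree

theorem toFun_injective (κ : PolynomialKnot n) : Function.Injective κ.toFun := fun s t h =>
  κ.injective s t fun i => congrArg (fun x : Euc n => x i) h

theorem continuous_toFun (κ : PolynomialKnot n) : Continuous κ.toFun :=
  (PiLp.continuous_toLp 2 _).comp (continuous_pi fun i => (κ.coord i).continuous)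

theorem tendsto_toFun (κ : PolynomialKnot n) :
    Tendsto κ.toFun (coclosedCompact ℝ) (coclosedCompact (Euc n)) := by
  obtain ⟨i, hi⟩ := κ.immersive 0
  have hdeg : 0 < (κ.coord i).degree := by
    by_contra hle
    rw [Polynomial.eq_C_of_degree_le_zero (not_lt.mp hle)] at hi
    simp at hi
  rw [coclosedCompact_eq_cocompact, coclosedCompact_eq_cocompact,
    ← Metric.cobounded_eq_cocompact (α := Euc n), ← tendsto_norm_atTop_iff_cobounded]
  refine tendsto_atTop_mono (fun t => ?_)
    ((κ.coord i).tendsto_norm_atTop hdeg (tendsto_norm_cocompact_atTop (E := ℝ)))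
  exact PiLp.norm_apply_le (κ.toFun t) i

/-- The completion (one point compactification) `κ̄ : S¹ → Sⁿ` of a polynomial knot `κ`: the
extension of `κ` by `κ̄(∞) = ∞`. -/
noncomputable def completion (κ : PolynomialKnot n) : TopologicalKnot n where
  toMap := ⟨OnePoint.map κ.toFun, OnePoint.continuous_map κ.continuous_toFun κ.tendsto_toFun⟩
  injective := Option.map_injective κ.toFun_injective

end PolynomialKnot

/-! The bound comes from counting critical points of a polynomial, after the part of the knot near
infinity has been replaced by a straight segment.

Even degree `d = 2m`. Up to sign, a coordinate of degree `d` tends to `+∞` at both ends. At a high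
enough level the curve has two points `κ(a)`, `κ(b)`; the arc between them lies strictly below this
level, and both tails rise monotonically above it. The tails together with `∞` can be moved onto the
chord from `κ(a)` to `κ(b)` by an orientation-preserving homeomorphism of the sphere that fixes the
arc (`exists_close_by_segment`). For this the tails are first straightened to vertical half-lines;
an inversion then turns them into a V-shaped graph below the image of the arc, and this graph is
pushed up to a horizontal segment. In any direction the height of the resulting knot is a polynomial
of degree at most `2m` on the arc and monotone on the chord. A nonzero derivative has at most `2m -
1` zeros; these include all maxima except possibly one at an end of the arc, and also a zero
strictly between any two maxima. Hence there are at most `m` maxima (`encard_localMaxima_le`,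
`superbridgeNumber_le_of_even`).

Odd degree `d = 2m + 1`. If the coordinate `z` has degree `d`, adding `ε t z(t)` to another
coordinate gives a long knot of even degree `2(m + 1)`, and the even case bounds its superbridge
number by `m + 1 = (d + 1)/2`. The knot type does not change (`PolynomialKnot.exists_raise_degree`):
along the curve the parameter `t` is a Lipschitz function of position, so the addition is the
restriction of a shear of space, which is bijective for small `ε`. -/

/-! ## Orientation preserving homeomorphisms of `ℝⁿ ∪ {∞}` -/

namespace IsOrientationPreserving

variable {X Y : Type*} [TopologicalSpace X] [TopologicalSpace Y]

theorem refl : IsOrientationPreserving (Homeomorph.refl X) :=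
  ContinuousMap.Homotopic.refl _

theorem trans {f g : X ≃ₜ X} (hf : IsOrientationPreserving f) (hg : IsOrientationPreserving g) :
    IsOrientationPreserving (f.trans g) :=
  ContinuousMap.Homotopic.comp hg hf

/-- A homotopy to the identity can be conjugated by any homeomorphism `e`, so whether the inversion
used below preserves orientation never has to be decided. -/
theorem conj {f : X ≃ₜ X} (hf : IsOrientationPreserving f) (e : X ≃ₜ Y) :
    IsOrientationPreserving ((e.symm.trans f).trans e) := by
  have h : ContinuousMap.Homotopic
      ((e : C(X, Y)).comp ((f : C(X, X)).comp (e.symm : C(Y, X))))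
      ((e : C(X, Y)).comp ((ContinuousMap.id X).comp (e.symm : C(Y, X)))) :=
    (ContinuousMap.Homotopic.refl _).comp (hf.comp (ContinuousMap.Homotopic.refl _))
  have h2 : (e : C(X, Y)).comp ((ContinuousMap.id X).comp (e.symm : C(Y, X)))
      = ContinuousMap.id Y := by
    ext y; simp
  rw [h2] at h
  exact h

end IsOrientationPreserving

/-- The final map of a continuous and proper deformation of the identity map of a space `E`,
if it is bijective, extends to an orientation preserving homeomorphism of `E ∪ {∞}`. -/
theorem exists_orientationPreserving_of_deformation {E : Type*} [NormedAddCommGroup E]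
    [ProperSpace E] (F : unitInterval → E → E) (hF : Continuous fun p : unitInterval × E => F p.1 p.2)
    (hproper : ∀ R : ℝ, ∃ R' : ℝ, ∀ s x, ‖F s x‖ ≤ R → ‖x‖ ≤ R')
    (h0 : ∀ x, F 0 x = x) (h1 : Function.Bijective (F 1)) :
    ∃ g : OnePoint E ≃ₜ OnePoint E, IsOrientationPreserving g ∧ g OnePoint.infty = OnePoint.infty ∧
      ∀ x : E, g x = (F 1 x : E) := by
  let H : unitInterval × OnePoint E → OnePoint E := fun p => OnePoint.map (F p.1) p.2
  have hH : Continuous H := by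
    rw [continuous_iff_continuousAt]
    rintro ⟨s, x⟩
    induction x using OnePoint.rec with
    | infty =>
      change Tendsto H (𝓝 (s, OnePoint.infty)) (𝓝 OnePoint.infty)
      rw [Tendsto, OnePoint.le_nhds_infty]
      intro K hK hKc
      obtain ⟨R, hR⟩ := hKc.isBounded.exists_norm_le
      obtain ⟨R', hR'⟩ := hproper R
      -- By properness, outside one ball no stage of the deformation lands in `K`; this gives a
      -- neighbourhood of `∞` that serves all times at once.
      have hU : ((fun x : E => (x : OnePoint E)) '' Metric.closedBall (0 : E) R')ᶜ
          ∈ 𝓝 (OnePoint.infty : OnePoint E) :=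
        (OnePoint.isOpen_compl_image_coe.2
          ⟨Metric.isClosed_closedBall, isCompact_closedBall _ _⟩).mem_nhds (by simp)
      rw [Filter.mem_map]
      refine mem_of_superset (prod_mem_nhds univ_mem hU) ?_
      rintro ⟨s', y⟩ ⟨-, hy⟩
      induction y using OnePoint.rec with
      | infty => right; rfl
      | coe y =>
        left
        refine ⟨F s' y, fun hm => hy ⟨y, ?_, rfl⟩, rfl⟩
        simpa using hR' s' y (hR _ hm)
    | coe x =>
      have hop : IsOpenEmbedding (Prod.map id (fun x : E => (x : OnePoint E)) :
          unitInterval × E → unitInterval × OnePoint E) :=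
        IsOpenEmbedding.id.prodMap OnePoint.isOpenEmbedding_coe
      have := hop.continuousAt_iff (g := H) (x := (s, x))
      refine this.1 ?_
      exact (OnePoint.continuous_coe.comp hF).continuousAt
  have hb : Function.Bijective (OnePoint.map (F 1)) := by
    refine ⟨Option.map_injective h1.1, fun y => ?_⟩
    induction y using OnePoint.rec with
    | infty => exact ⟨OnePoint.infty, rfl⟩
    | coe y => obtain ⟨x, rfl⟩ := h1.2 y; exact ⟨x, rfl⟩
  -- Only the final map has to be bijective: a continuous bijection of a compact Hausdorff space is
  -- a homeomorphism.
  have hc : Continuous (Equiv.ofBijective _ hb) := hH.comp (Continuous.prodMk_right 1)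
  refine ⟨hc.homeoOfEquivCompactToT2, ?_, rfl, fun x => rfl⟩
  refine ContinuousMap.Homotopic.symm ⟨⟨⟨H, hH⟩, fun x => ?_, fun x => rfl⟩⟩
  induction x using OnePoint.rec with
  | infty => rfl
  | coe x => exact congrArg _ (h0 x)

/-! ## A box shaped inversion of `ℂ × ℝ ∪ {∞}` -/

/-- The gauge `max (η |w|²) |ζ|`, homogeneous for the dilations `(r w, r² ζ)`. -/
noncomputable def boxGauge (η : ℝ) (x : ℂ × ℝ) : ℝ := max (η * ‖x.1‖ ^ 2) |x.2|

/-- The inversion `(w, ζ) ↦ (w / N, ζ / N²)`, where `N` is the gauge of `(w, ζ)`. -/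
noncomputable def boxInv (η : ℝ) (x : ℂ × ℝ) : ℂ × ℝ :=
  (x.1 / (boxGauge η x : ℂ), x.2 / boxGauge η x ^ 2)

theorem continuous_boxGauge (η : ℝ) : Continuous (boxGauge η) := by
  unfold boxGauge; fun_prop

theorem boxGauge_zero (η : ℝ) : boxGauge η 0 = 0 := by simp [boxGauge]

theorem boxGauge_pos {η : ℝ} (hη : 0 < η) {x : ℂ × ℝ} (hx : x ≠ 0) : 0 < boxGauge η x := by
  rw [boxGauge, lt_max_iff]
  by_contra! h
  apply hx
  have h1 : x.1 = 0 := by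
    have : ‖x.1‖ ^ 2 ≤ 0 := by
      by_contra! h'
      exact absurd (mul_pos hη h') (not_lt.2 h.1)
    simpa using this
  exact Prod.ext h1 (by simpa using h.2)

/-- The gauge has degree 2 under the dilations `(r w, r² ζ)`, so `r = 1 / N` turns `N` into `N /
N²`. This makes the inversion an involution. -/
theorem boxGauge_boxInv {η : ℝ} (hη : 0 < η) {x : ℂ × ℝ} (hx : x ≠ 0) :
    boxGauge η (boxInv η x) = (boxGauge η x)⁻¹ := by
  have h := boxGauge_pos hη hx
  have e : boxGauge η (boxInv η x) = max (η * ‖x.1‖ ^ 2) |x.2| / boxGauge η x ^ 2 := by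
    rw [← max_div_div_right (by positivity : (0:ℝ) ≤ boxGauge η x ^ 2), boxGauge]
    simp only [boxInv, norm_div, Complex.norm_real, Real.norm_eq_abs, abs_of_pos h, abs_div,
      abs_pow]
    congr 1
    rw [div_pow, mul_div_assoc]
  rw [e]
  change boxGauge η x / _ = _
  field_simp

theorem boxInv_ne_zero {η : ℝ} (hη : 0 < η) {x : ℂ × ℝ} (hx : x ≠ 0) : boxInv η x ≠ 0 := by
  intro h
  have := boxGauge_boxInv hη hx
  rw [h, boxGauge_zero] at this
  exact (inv_pos.2 (boxGauge_pos hη hx)).ne this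

theorem boxInv_boxInv {η : ℝ} (hη : 0 < η) {x : ℂ × ℝ} (hx : x ≠ 0) :
    boxInv η (boxInv η x) = x := by
  have h := boxGauge_pos hη hx
  have h' : (boxGauge η x : ℂ) ≠ 0 := by exact_mod_cast h.ne'
  have e := boxGauge_boxInv hη hx
  rw [boxInv, e]
  refine Prod.ext ?_ ?_
  · simp only [boxInv]; push_cast; field_simp
  · simp only [boxInv]; field_simp

/-- In this region the inversion is `(w / ζ, 1 / ζ)`. It takes the lines `w = ±1` to the graph `U =
|s|`, and the part with `ζ ≤ 1` to `U ≥ 1`. -/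
theorem boxInv_of_gauge {η ζ : ℝ} {w : ℂ} (hζ : 0 ≤ ζ) (h : η * ‖w‖ ^ 2 ≤ ζ) :
    boxInv η (w, ζ) = (w / (ζ : ℂ), ζ⁻¹) := by
  have : boxGauge η (w, ζ) = ζ := by
    rw [boxGauge]; simp only [abs_of_nonneg hζ]; exact max_eq_right h
  rw [boxInv, this]
  refine Prod.ext rfl ?_
  rcases eq_or_ne ζ 0 with rfl | h0
  · simp
  · field_simp

theorem tendsto_boxGauge {η : ℝ} (hη : 0 < η) :
    Tendsto (boxGauge η) (cocompact (ℂ × ℝ)) atTop := by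
  rw [tendsto_atTop]
  intro R
  rw [← Metric.cobounded_eq_cocompact]
  have hb : Bornology.IsBounded {x : ℂ × ℝ | ¬ R ≤ boxGauge η x} := ?_
  · exact mem_of_superset (Bornology.isBounded_def.1 hb) fun x hx => not_not.1 hx
  rw [isBounded_iff_forall_norm_le]
  refine ⟨max (√(R / η)) R, fun x hx => ?_⟩
  simp only [Set.mem_ofPred_eq, not_le, boxGauge, max_lt_iff] at hx
  rw [Prod.norm_def]
  refine max_le_max (Real.le_sqrt_of_sq_le ?_) hx.2.le
  rw [le_div_iff₀ hη]
  linarith [hx.1]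

/-- The definition of `N` gives `|w / N|² ≤ 1 / (η N)` and `|ζ| / N² ≤ 1 / N`. -/
theorem tendsto_boxInv {η : ℝ} (hη : 0 < η) :
    Tendsto (boxInv η) (cocompact (ℂ × ℝ)) (𝓝 0) := by
  have hN := tendsto_boxGauge hη
  have hi : Tendsto (fun x => (boxGauge η x)⁻¹) (cocompact (ℂ × ℝ)) (𝓝 0) :=
    tendsto_inv_atTop_zero.comp hN
  rw [show (0 : ℂ × ℝ) = ((0 : ℂ), (0 : ℝ)) from rfl]
  refine Tendsto.prodMk_nhds ?_ ?_
  · rw [tendsto_zero_iff_norm_tendsto_zero]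
    have hs : Tendsto (fun x => √(η⁻¹ * (boxGauge η x)⁻¹)) (cocompact (ℂ × ℝ)) (𝓝 0) := by
      simpa using (hi.const_mul η⁻¹).sqrt
    refine squeeze_zero' (Eventually.of_forall fun _ => norm_nonneg _) ?_ hs
    filter_upwards [hN.eventually_gt_atTop 0] with x hx
    apply Real.le_sqrt_of_sq_le
    rw [norm_div, Complex.norm_real, Real.norm_eq_abs, abs_of_pos hx, div_pow]
    have : η * ‖x.1‖ ^ 2 ≤ boxGauge η x := le_max_left _ _
    rw [div_le_iff₀ (by positivity)]
    field_simp
    linarith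
  · rw [tendsto_zero_iff_norm_tendsto_zero]
    refine squeeze_zero' (Eventually.of_forall fun _ => norm_nonneg _) ?_ hi
    filter_upwards [hN.eventually_gt_atTop 0] with x hx
    have : |x.2| ≤ boxGauge η x := le_max_right _ _
    rw [norm_div, Real.norm_eq_abs, Real.norm_eq_abs, abs_of_pos (pow_pos hx 2),
      div_le_iff₀ (by positivity)]
    field_simp
    linarith

theorem continuousAt_boxInv {η : ℝ} (hη : 0 < η) {x : ℂ × ℝ} (hx : x ≠ 0) :
    ContinuousAt (boxInv η) x := by
  have h := (boxGauge_pos hη hx).ne'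
  have hc := (continuous_boxGauge η).continuousAt (x := x)
  refine ContinuousAt.prodMk ?_ ?_
  · exact continuousAt_fst.div (Complex.continuous_ofReal.continuousAt.comp hc)
      (by exact_mod_cast h)
  · exact continuousAt_snd.div (hc.pow 2) (pow_ne_zero 2 h)

open Classical in
/-- The extension of the box inversion to `ℂ × ℝ ∪ {∞}`. -/
noncomputable def boxInvOnePoint (η : ℝ) : OnePoint (ℂ × ℝ) → OnePoint (ℂ × ℝ) :=
  fun x => x.elim ((0 : ℂ × ℝ) : OnePoint (ℂ × ℝ))
    fun x => if x = 0 then OnePoint.infty else (boxInv η x : ℂ × ℝ)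

theorem boxInvOnePoint_infty (η : ℝ) :
    boxInvOnePoint η OnePoint.infty = ((0 : ℂ × ℝ) : OnePoint (ℂ × ℝ)) := rfl

theorem boxInvOnePoint_zero (η : ℝ) :
    boxInvOnePoint η ((0 : ℂ × ℝ) : OnePoint (ℂ × ℝ)) = OnePoint.infty := by
  simp [boxInvOnePoint]

theorem boxInvOnePoint_coe (η : ℝ) {x : ℂ × ℝ} (hx : x ≠ 0) :
    boxInvOnePoint η (x : OnePoint (ℂ × ℝ)) = (boxInv η x : ℂ × ℝ) := by
  simp [boxInvOnePoint, hx]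

theorem boxInvOnePoint_involutive {η : ℝ} (hη : 0 < η) :
    Function.Involutive (boxInvOnePoint η) := by
  intro x
  induction x using OnePoint.rec with
  | infty => rw [boxInvOnePoint_infty, boxInvOnePoint_zero]
  | coe x =>
    rcases eq_or_ne x 0 with rfl | hx
    · rw [boxInvOnePoint_zero, boxInvOnePoint_infty]
    · rw [boxInvOnePoint_coe η hx, boxInvOnePoint_coe η (boxInv_ne_zero hη hx),
        boxInv_boxInv hη hx]

theorem continuous_boxInvOnePoint {η : ℝ} (hη : 0 < η) : Continuous (boxInvOnePoint η) := by
  rw [continuous_iff_continuousAt]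
  intro x
  induction x using OnePoint.rec with
  | infty =>
    rw [OnePoint.continuousAt_infty', coclosedCompact_eq_cocompact]
    refine ((OnePoint.continuous_coe.tendsto (0 : ℂ × ℝ)).comp (tendsto_boxInv hη)).congr' ?_
    have : ∀ᶠ x : ℂ × ℝ in cocompact (ℂ × ℝ), x ≠ 0 := by
      filter_upwards [(tendsto_boxGauge hη).eventually_gt_atTop 0] with x hx h
      simp [h, boxGauge_zero] at hx
    filter_upwards [this] with x hx
    exact (boxInvOnePoint_coe η hx).symm
  | coe x =>
    rw [OnePoint.continuousAt_coe]
    rcases eq_or_ne x 0 with rfl | hx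
    · rw [ContinuousAt, Function.comp_apply, boxInvOnePoint_zero, Tendsto, OnePoint.le_nhds_infty]
      intro K hK hKc
      obtain ⟨R, hR⟩ := (hKc.image (continuous_boxGauge η)).bddAbove
      have hev : ∀ᶠ x in 𝓝 (0 : ℂ × ℝ), boxGauge η x < (max R 1)⁻¹ := by
        refine (continuous_boxGauge η).continuousAt.eventually_lt continuousAt_const ?_
        rw [boxGauge_zero]; positivity
      rw [Filter.mem_map]
      filter_upwards [hev] with x hx
      rcases eq_or_ne x 0 with rfl | h0
      · right; exact boxInvOnePoint_zero η
      · left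
        refine ⟨boxInv η x, fun hm => ?_, (boxInvOnePoint_coe η h0).symm⟩
        have h2 := hR ⟨_, hm, rfl⟩
        rw [boxGauge_boxInv hη h0] at h2
        have h3 := (lt_inv_comm₀ (boxGauge_pos hη h0) (by positivity)).1 hx
        linarith [le_max_left R 1]
    · refine (OnePoint.continuous_coe.continuousAt.comp (continuousAt_boxInv hη hx)).congr ?_
      filter_upwards [isOpen_ne.mem_nhds hx] with y hy
      exact (boxInvOnePoint_coe η hy).symm

/-- The box inversion as a homeomorphism of `ℂ × ℝ ∪ {∞}`. -/
noncomputable def boxInvHomeo {η : ℝ} (hη : 0 < η) : OnePoint (ℂ × ℝ) ≃ₜ OnePoint (ℂ × ℝ) :=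
  Continuous.homeoOfEquivCompactToT2 (f := (boxInvOnePoint_involutive hη).toPerm)
    (continuous_boxInvOnePoint hη)

theorem boxInvHomeo_apply {η : ℝ} (hη : 0 < η) (x : OnePoint (ℂ × ℝ)) :
    boxInvHomeo hη x = boxInvOnePoint η x := rfl

theorem boxInvHomeo_symm_apply {η : ℝ} (hη : 0 < η) (x : OnePoint (ℂ × ℝ)) :
    (boxInvHomeo hη).symm x = boxInvOnePoint η x := rfl

/-! ## Pushing a graph upwards -/

/-- The piecewise linear function of `u` with `-τ ↦ 0`, equal to `u ↦ u + τ` for `u ≤ -τ` and to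
the identity for large `u` (for `r < 1`). -/
noncomputable def pushUp (τ r u : ℝ) : ℝ := max u (min (u + τ) ((u + τ) * r))

theorem le_pushUp (τ r u : ℝ) : u ≤ pushUp τ r u := le_max_left _ _

theorem pushUp_le {τ : ℝ} (hτ : 0 ≤ τ) (r u : ℝ) : pushUp τ r u ≤ u + τ :=
  max_le (by linarith) (min_le_left _ _)

/-- For `τ = 0` the map is the identity whatever `r` is, so the slope may degenerate where nothing
has to be pushed. -/
theorem pushUp_strictMono {τ r : ℝ} (hτ : 0 ≤ τ) (h : τ = 0 ∨ 0 < r) :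
    StrictMono (pushUp τ r) := by
  intro u u' huu
  rcases h with rfl | h
  · have := pushUp_le le_rfl r u
    have := le_pushUp 0 r u'
    linarith
  · refine max_lt_max huu (min_lt_min (by linarith) ?_)
    exact mul_lt_mul_of_pos_right (by linarith) h

theorem pushUp_neg {τ : ℝ} (hτ : 0 ≤ τ) (r : ℝ) : pushUp τ r (-τ) = 0 := by
  simp [pushUp, hτ]

theorem pushUp_eq_self {τ r u : ℝ} (h : (u + τ) * r ≤ u) : pushUp τ r u = u :=
  max_eq_left ((min_le_right _ _).trans h)

theorem continuous_pushUp : Continuous fun p : ℝ × ℝ × ℝ => pushUp p.1 p.2.1 p.2.2 := by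
  unfold pushUp; fun_prop

/-- If a closed set `A` lies above the plane `U = 1` and touches it only above the unit circle,
then the graph `U = |s|` can be pushed up to this plane, keeping `A` fixed. -/
theorem exists_push {A : Set (ℂ × ℝ)} (hA : IsClosed A) (hne : A.Nonempty)
    (h1 : ∀ p ∈ A, 1 ≤ p.2) (h2 : ∀ p ∈ A, p.2 = 1 → ‖p.1‖ = 1) :
    ∃ g : OnePoint (ℂ × ℝ) ≃ₜ OnePoint (ℂ × ℝ), IsOrientationPreserving g ∧
      (∀ p ∈ A, g p = (p : OnePoint (ℂ × ℝ))) ∧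
      ∀ s : ℝ, |s| ≤ 1 → g (((s : ℂ), |s|) : ℂ × ℝ) = (((s : ℂ), 1) : ℂ × ℝ) := by
  -- Over `w`, `τ` is the height to be gained and `r` the slope of the compressed part. The slope is
  -- small where `A` comes close to the plane, and vanishes only at contact points, where `τ = 0` by
  -- `h2`.
  let τ : ℂ → ℝ := fun w => max 0 (1 - ‖w‖)
  let δ : ℂ → ℝ := fun w => Metric.infDist ((w, 1) : ℂ × ℝ) A
  let r : ℂ → ℝ := fun w => min 1 (δ w) / 2
  have hτ0 : ∀ w, 0 ≤ τ w := fun w => le_max_left _ _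
  have hτ1 : ∀ w, τ w ≤ 1 := fun w => max_le zero_le_one (by linarith [norm_nonneg w])
  have hδ0 : ∀ w, 0 ≤ δ w := fun w => Metric.infDist_nonneg
  have hr0 : ∀ w, 0 ≤ r w := fun w => div_nonneg (le_min zero_le_one (hδ0 w)) zero_le_two
  have hr1 : ∀ w, r w ≤ 1 / 2 := fun w => by
    have := min_le_left 1 (δ w)
    change min 1 (δ w) / 2 ≤ _
    linarith
  have hrδ : ∀ w, r w ≤ δ w / 2 := fun w => by
    have := min_le_right 1 (δ w)
    change min 1 (δ w) / 2 ≤ _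
    linarith
  have hτr : ∀ w, τ w = 0 ∨ 0 < r w := by
    intro w
    rcases (hδ0 w).eq_or_lt with h | h
    · left
      have hm : ((w, 1) : ℂ × ℝ) ∈ A := (hA.mem_iff_infDist_zero hne).2 h.symm
      have : ‖w‖ = 1 := h2 _ hm rfl
      simp only [τ]
      rw [this]; simp
    · right
      exact div_pos (lt_min one_pos h) two_pos
  have hcτ : Continuous τ := by fun_prop
  have hcδ : Continuous δ := by
    exact (Metric.continuous_infDist_pt A).comp (by fun_prop)
  have hcr : Continuous r := by fun_prop
  let F : unitInterval → ℂ × ℝ → ℂ × ℝ := fun s p =>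
    (p.1, p.2 + s * (1 + pushUp (τ p.1) (r p.1) (p.2 - 1) - p.2))
  have hF1 : ∀ p, F 1 p = (p.1, 1 + pushUp (τ p.1) (r p.1) (p.2 - 1)) := fun p =>
    Prod.ext rfl (by simp [F])
  have hdisp : ∀ w u, |1 + pushUp (τ w) (r w) (u - 1) - u| ≤ 1 := by
    intro w u
    have := le_pushUp (τ w) (r w) (u - 1)
    have := pushUp_le (hτ0 w) (r w) (u - 1)
    have := hτ1 w
    rw [abs_le]; constructor <;> linarith
  have key := exists_orientationPreserving_of_deformation F ?_ ?_ ?_ ?_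
  · obtain ⟨g, hg, -, hgF⟩ := key
    refine ⟨g, hg, fun p hp => ?_, fun s hs => ?_⟩
    · rw [hgF, hF1]
      have hle : δ p.1 ≤ p.2 - 1 := by
        refine (Metric.infDist_le_dist_of_mem hp).trans ?_
        rw [Prod.dist_eq]
        have := h1 p hp
        simp only [dist_self, Real.dist_eq]
        rw [abs_of_nonpos (by linarith)]
        exact max_le (by linarith) (by linarith)
      rw [pushUp_eq_self]
      · congr 1; exact Prod.ext rfl (by simp)
      -- With `u = p.2 - 1 ≥ δ`, the bounds `r ≤ 1/2`, `r ≤ δ/2` and `τ ≤ 1` give `(u + τ) r ≤ u/2 +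
      -- δ/2 ≤ u`.
      · have a1 := hτ1 p.1
        have a2 := hr0 p.1
        have a3 := hr1 p.1
        have a4 := hrδ p.1
        have a5 := hδ0 p.1
        nlinarith [mul_le_mul_of_nonneg_right a1 a2, mul_nonneg (a5.trans hle) (sub_nonneg.2 a3)]
    · rw [hgF, hF1]
      have e : τ (s : ℂ) = 1 - |s| := by
        simp only [τ, Complex.norm_real, Real.norm_eq_abs]
        exact max_eq_right (by linarith)
      have e2 : |s| - 1 = -(τ (s : ℂ)) := by rw [e]; ring
      simp only [e2, pushUp_neg (hτ0 _), add_zero]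
  · have := continuous_pushUp
    have h3 : Continuous fun p : unitInterval × ℂ × ℝ =>
        pushUp (τ p.2.1) (r p.2.1) (p.2.2 - 1) :=
      this.comp (f := fun p : unitInterval × ℂ × ℝ => (τ p.2.1, r p.2.1, p.2.2 - 1)) (by fun_prop)
    fun_prop
  · intro R
    refine ⟨max R (R + 1), fun s p hp => ?_⟩
    rw [Prod.norm_def] at hp ⊢
    have ha : ‖(F s p).2‖ ≤ R := (le_max_right _ _).trans hp
    refine max_le_max ((le_max_left _ _).trans hp) ?_
    have hd := hdisp p.1 p.2
    have hs : |(s : ℝ) * (1 + pushUp (τ p.1) (r p.1) (p.2 - 1) - p.2)| ≤ 1 := by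
      rw [abs_mul, abs_of_nonneg s.2.1]
      exact mul_le_one₀ s.2.2 (abs_nonneg _) hd
    simp only [F, Real.norm_eq_abs] at ha ⊢
    rw [abs_le] at *
    constructor <;> linarith [hs.1, hs.2, ha.1, ha.2]
  · intro p
    exact Prod.ext rfl (by simp [F])
  · constructor
    · rintro ⟨w, u⟩ ⟨w', u'⟩ h
      rw [hF1, hF1] at h
      obtain ⟨h3, h4⟩ := Prod.ext_iff.1 h
      simp only at h3 h4
      subst h3
      have := (pushUp_strictMono (hτ0 w) (hτr w)).injective (add_left_cancel h4)
      exact Prod.ext rfl (by simpa using this)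
    · rintro ⟨w, y⟩
      have hc : Continuous fun u => 1 + pushUp (τ w) (r w) (u - 1) := by
        have := continuous_pushUp.comp
          (f := fun u : ℝ => (τ w, r w, u - 1)) (by fun_prop)
        exact continuous_const.add this
      have hsurj : Function.Surjective fun u => 1 + pushUp (τ w) (r w) (u - 1) := by
        refine hc.surjective ?_ ?_
        · refine tendsto_atTop_mono (f := fun u => u) (fun u => ?_) tendsto_id
          linarith [le_pushUp (τ w) (r w) (u - 1)]
        · refine tendsto_atBot_mono (f := fun u : ℝ => u + 1) (fun u => ?_)
            (tendsto_atBot_add_const_right _ _ tendsto_id)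
          linarith [pushUp_le (hτ0 w) (r w) (u - 1), hτ1 w]
      obtain ⟨u, hu⟩ := hsurj y
      exact ⟨(w, u), by rw [hF1]; exact Prod.ext rfl hu⟩

/-! ## Straightening two strands -/

/-- Two disjoint strands `(P c, c)` and `(Q c, c)`, vertical for `c ≤ 0`, can be made vertical. -/
theorem exists_straighten {P Q : ℝ → ℂ} (hP : Continuous P) (hQ : Continuous Q)
    (hPQ : ∀ c, P c ≠ Q c) (hP0 : P 0 = 1) (hQ0 : Q 0 = -1) :
    ∃ g : OnePoint (ℂ × ℝ) ≃ₜ OnePoint (ℂ × ℝ), IsOrientationPreserving g ∧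
      g OnePoint.infty = OnePoint.infty ∧
      ∀ w c, g ((w, c) : ℂ × ℝ) = (((2 * w - P c - Q c) / (P c - Q c), c) : ℂ × ℝ) := by
  -- Each level is moved by the affine map of `ℂ` taking the two strands to `1` and `-1`. Evaluating
  -- them at height `s c` starts the deformation at the identity.
  let F : unitInterval → ℂ × ℝ → ℂ × ℝ := fun s p =>
    ((2 * p.1 - P (s * p.2) - Q (s * p.2)) / (P (s * p.2) - Q (s * p.2)), p.2)
  have hd : ∀ c, P c - Q c ≠ 0 := fun c => sub_ne_zero.2 (hPQ c)
  have key := exists_orientationPreserving_of_deformation F ?_ ?_ ?_ ?_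
  · obtain ⟨g, hg, hgi, hgF⟩ := key
    refine ⟨g, hg, hgi, fun w c => ?_⟩
    rw [hgF]; simp [F]
  · refine Continuous.prodMk (Continuous.div (by fun_prop) (by fun_prop) fun p => hd _)
      (by fun_prop)
  · intro R
    obtain ⟨B, hB⟩ := (isCompact_Icc (a := -R) (b := R)).exists_bound_of_continuousOn
      hP.continuousOn
    obtain ⟨B', hB'⟩ := (isCompact_Icc (a := -R) (b := R)).exists_bound_of_continuousOn
      hQ.continuousOn
    refine ⟨max ((R + 1) * (B + B') / 2) R, fun s p hp => ?_⟩
    rw [Prod.norm_def] at hp ⊢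
    have h1 : ‖(F s p).1‖ ≤ R := (le_max_left _ _).trans hp
    have h2 : |p.2| ≤ R := (le_max_right _ _).trans hp
    have hm : (s : ℝ) * p.2 ∈ Set.Icc (-R) R := by
      rw [Set.mem_Icc, ← abs_le, abs_mul, abs_of_nonneg s.2.1]
      exact (mul_le_of_le_one_left (abs_nonneg _) s.2.2).trans h2
    refine max_le_max ?_ h2
    have b1 := hB _ hm
    have b2 := hB' _ hm
    have hxy : P (s * p.2) - Q (s * p.2) ≠ 0 := hd _
    have e : p.1 = ((F s p).1 * (P (s * p.2) - Q (s * p.2)) + (P (s * p.2) + Q (s * p.2))) / 2 := by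
      simp only [F]
      field_simp
      ring
    generalize P (s * p.2) = x at *
    generalize Q (s * p.2) = y at *
    have hR : 0 ≤ R := (abs_nonneg _).trans h2
    have h3 : ‖x - y‖ ≤ B + B' := (norm_sub_le _ _).trans (add_le_add b1 b2)
    have h4 : ‖x + y‖ ≤ B + B' := (norm_add_le _ _).trans (add_le_add b1 b2)
    rw [e, norm_div, Complex.norm_ofNat]
    refine div_le_div_of_nonneg_right ((norm_add_le _ _).trans ?_) zero_le_two
    rw [norm_mul]
    have := mul_le_mul h1 h3 (norm_nonneg _) hR
    linarith
  · rintro ⟨w, c⟩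
    refine Prod.ext ?_ rfl
    simp only [F, Set.Icc.coe_zero, zero_mul, hP0, hQ0]
    ring
  · constructor
    · rintro ⟨w, c⟩ ⟨w', c'⟩ h
      obtain ⟨h3, h4⟩ := Prod.ext_iff.1 h
      simp only [F, Set.Icc.coe_one, one_mul] at h3 h4
      subst h4
      rw [div_left_inj' (hd c)] at h3
      refine Prod.ext ?_ rfl
      linear_combination h3 / 2
    · rintro ⟨w, c⟩
      refine ⟨((w * (P c - Q c) + P c + Q c) / 2, c), Prod.ext ?_ rfl⟩
      simp only [F, Set.Icc.coe_one, one_mul]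
      rw [div_eq_iff (hd c)]
      ring

/-- The inverse of a function that increases to infinity on `[b, ∞)`. -/
theorem exists_tail_inverse {z : ℝ → ℝ} (hz : Continuous z) {b : ℝ} (hb : z b = 0)
    (hm : StrictMonoOn z (Set.Ici b)) (ht : Tendsto z atTop atTop) :
    ∃ θ : ℝ → ℝ, Continuous θ ∧ (∀ c, b ≤ θ c) ∧ (∀ c ≤ 0, θ c = b) ∧ (∀ t, b ≤ t → θ (z t) = t) ∧
      ∀ c, z (θ c) = max c 0 := by
  -- Continuing `z` with slope 1 to the left of `b` gives a homeomorphism of `ℝ`, whose inverse is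
  -- continuous.
  let Z : ℝ → ℝ := fun t => z (max t b) + min (t - b) 0
  have hZ : ∀ t, b ≤ t → Z t = z t := fun t h => by
    simp [Z, max_eq_left h, min_eq_right (sub_nonneg.2 h)]
  have hZmono : StrictMono Z := by
    intro s t hst
    rcases lt_or_ge t b with h | h
    · have h1 : max s b = b := max_eq_right (by linarith)
      have h2 : max t b = b := max_eq_right h.le
      simp only [Z, h1, h2]
      rw [min_eq_left (by linarith), min_eq_left (by linarith)]
      linarith
    · have h1 : z (max s b) ≤ z (max t b) :=
        hm.monotoneOn (le_max_right s b) (le_max_right t b) (max_le_max_right b hst.le)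
      rcases lt_or_ge s b with h' | h'
      · simp only [Z]
        rw [min_eq_left (by linarith : s - b ≤ 0), min_eq_right (by linarith : 0 ≤ t - b)]
        linarith
      · rw [hZ s h', hZ t h]
        exact hm h' h hst
  have hZc : Continuous Z := by fun_prop
  have hZs : Function.Surjective Z := by
    refine hZc.surjective ?_ ?_
    · refine ht.congr' ?_
      filter_upwards [eventually_ge_atTop b] with t h using (hZ t h).symm
    · have : Tendsto (fun t : ℝ => t - b) atBot atBot :=
        tendsto_atBot_add_const_right _ _ tendsto_id
      refine this.congr' ?_
      filter_upwards [eventually_le_atBot b] with t h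
      simp [Z, hb, h]
  let e := (hZmono.orderIsoOfSurjective Z hZs).toHomeomorph
  have he : ∀ t, e t = Z t := fun t => rfl
  have hsymm : ∀ t, b ≤ t → e.symm (z t) = t := fun t h => by
    rw [← hZ t h, ← he, e.symm_apply_apply]
  have hge : ∀ c, b ≤ e.symm (max c 0) := fun c => by
    rw [← hZmono.le_iff_le, ← he (e.symm _), e.apply_symm_apply, hZ b le_rfl, hb]
    exact le_max_right _ _
  refine ⟨fun c => e.symm (max c 0), by fun_prop, hge, fun c hc => ?_, fun t h => ?_, fun c => ?_⟩
  · change e.symm (max c 0) = b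
    rw [max_eq_right hc, ← hb, hsymm b le_rfl]
  · change e.symm (max (z t) 0) = t
    rw [max_eq_left, hsymm t h]
    rw [← hb]
    exact hm.monotoneOn (Set.self_mem_Ici) h h
  · change z (e.symm (max c 0)) = _
    rw [← hZ _ (hge c), ← he, e.apply_symm_apply]

/-! ## Closing a long knot by a segment -/

/-- A long knot in `ℂ × ℝ` whose two tails rise to infinity above an arc: the tails, together with
the point at infinity, can be moved to the segment joining the endpoints of the arc. -/
theorem exists_close_by_segment {γ : ℝ → ℂ × ℝ} (hγ : Continuous γ) (hinj : Function.Injective γ)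
    {a b : ℝ} (hab : a < b) (ha : γ a = (-1, 0)) (hb : γ b = (1, 0))
    (hpos : ∀ t, -1 < (γ t).2) (hneg : ∀ t ∈ Set.Ioo a b, (γ t).2 < 0)
    (hanti : StrictAntiOn (fun t => (γ t).2) (Set.Iic a))
    (hmono : StrictMonoOn (fun t => (γ t).2) (Set.Ici b))
    (htop : Tendsto (fun t => (γ t).2) atTop atTop)
    (hbot : Tendsto (fun t => (γ t).2) atBot atTop) :
    ∃ g : OnePoint (ℂ × ℝ) ≃ₜ OnePoint (ℂ × ℝ), IsOrientationPreserving g ∧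
      (∀ t ∈ Set.Icc a b, g (γ t) = (γ t : OnePoint (ℂ × ℝ))) ∧
      (∀ t, b ≤ t → g (γ t) = ((((1 + (γ t).2)⁻¹ : ℝ) : ℂ), (0 : ℝ))) ∧
      (∀ t, t ≤ a → g (γ t) = (((-(1 + (γ t).2)⁻¹ : ℝ) : ℂ), (0 : ℝ))) ∧
      g OnePoint.infty = (((0 : ℝ) : ℂ), (0 : ℝ)) := by
  obtain ⟨θ, hθ, hθb, hθ0, hθz, hzθ⟩ := exists_tail_inverse (z := fun t => (γ t).2) (by fun_prop)
    (by simp [hb]) hmono htop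
  obtain ⟨θ', hθ', hθa, hθ0', hθz', hzθ'⟩ := exists_tail_inverse (z := fun t => (γ (-t)).2)
    (b := -a) (by fun_prop) (by simp [ha])
    (fun s hs t ht hst => hanti (neg_le.1 (Set.mem_Ici.1 ht)) (neg_le.1 (Set.mem_Ici.1 hs))
      (neg_lt_neg hst))
    (hbot.comp tendsto_neg_atTop_atBot)
  -- The right and left tails, parametrised by height.
  let P : ℝ → ℂ := fun c => (γ (θ c)).1
  let Q : ℝ → ℂ := fun c => (γ (-θ' c)).1
  have hPQ : ∀ c, P c ≠ Q c := by
    intro c h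
    have : γ (θ c) = γ (-θ' c) := Prod.ext h ((hzθ c).trans (hzθ' c).symm)
    have := hinj this
    linarith [hθb c, hθa c]
  have hP0 : ∀ c ≤ 0, P c = 1 := fun c hc => by simp only [P, hθ0 c hc, hb]
  have hQ0 : ∀ c ≤ 0, Q c = -1 := fun c hc => by simp only [Q, hθ0' c hc, neg_neg, ha]
  obtain ⟨g₁, hg₁, hg₁i, hg₁s⟩ := exists_straighten (P := P) (Q := Q) (by fun_prop) (by fun_prop)
    hPQ (hP0 0 le_rfl) (hQ0 0 le_rfl)
  have harc : ∀ t ∈ Set.Icc a b, (γ t).2 ≤ 0 := by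
    intro t ht
    rcases ht.1.eq_or_lt with rfl | h
    · simp [ha]
    rcases ht.2.eq_or_lt with rfl | h'
    · simp [hb]
    · exact (hneg t ⟨h, h'⟩).le
  -- After a translation by 1 the arc lies at positive height, so by compactness a small `η` puts it
  -- where the gauge equals the height; `η ≤ 1` does the same for the straightened tails.
  obtain ⟨η, hη, hη1, hηarc⟩ : ∃ η : ℝ, 0 < η ∧ η ≤ 1 ∧
      ∀ t ∈ Set.Icc a b, η * ‖(γ t).1‖ ^ 2 ≤ 1 + (γ t).2 := by
    have hc : ContinuousOn (fun t => (1 + (γ t).2) / (1 + ‖(γ t).1‖ ^ 2)) (Set.Icc a b) := by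
      refine Continuous.continuousOn (Continuous.div (by fun_prop) (by fun_prop) fun t => ?_)
      positivity
    obtain ⟨t₀, -, ht₀⟩ := isCompact_Icc.exists_isMinOn (Set.nonempty_Icc.2 hab.le) hc
    have hp : 0 < (1 + (γ t₀).2) / (1 + ‖(γ t₀).1‖ ^ 2) :=
      div_pos (by linarith [hpos t₀]) (by positivity)
    refine ⟨min 1 _, lt_min one_pos hp, min_le_left _ _, fun t ht => ?_⟩
    have h1 : min 1 ((1 + (γ t₀).2) / (1 + ‖(γ t₀).1‖ ^ 2))
        ≤ (1 + (γ t).2) / (1 + ‖(γ t).1‖ ^ 2) := (min_le_right _ _).trans (ht₀ ht)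
    rw [le_div_iff₀ (by positivity)] at h1
    have h2 : 0 < min 1 ((1 + (γ t₀).2) / (1 + ‖(γ t₀).1‖ ^ 2)) := lt_min one_pos hp
    nlinarith
  let q : ℝ → ℂ × ℝ := fun t => ((γ t).1 / ((1 + (γ t).2 : ℝ) : ℂ), (1 + (γ t).2)⁻¹)
  have hqc : Continuous q := by
    refine Continuous.prodMk (Continuous.div (by fun_prop) (by fun_prop) fun t => ?_)
      (Continuous.inv₀ (by fun_prop) fun t => ?_)
    · exact_mod_cast (by linarith [hpos t] : 0 < 1 + (γ t).2).ne'
    · linarith [hpos t]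
  have hqbox : ∀ t ∈ Set.Icc a b, boxInv η ((γ t).1, 1 + (γ t).2) = q t := fun t ht =>
    boxInv_of_gauge (by linarith [hpos t]) (hηarc t ht)
  obtain ⟨V, hV, hVA, hVs⟩ := exists_push (A := q '' Set.Icc a b)
    (isCompact_Icc.image hqc).isClosed ((Set.nonempty_Icc.2 hab.le).image q)
    (by
      rintro - ⟨t, ht, rfl⟩
      exact (one_le_inv₀ (by linarith [hpos t])).2 (by linarith [harc t ht]))
    (by
      rintro - ⟨t, ht, rfl⟩ h
      have hz : (γ t).2 = 0 := by
        have := inv_eq_one.1 h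
        linarith
      rcases ht.1.eq_or_lt with rfl | h1
      · simp [q, ha]
      rcases ht.2.eq_or_lt with rfl | h2
      · simp [q, hb]
      · exact absurd hz (hneg t ⟨h1, h2⟩).ne)
  let e : OnePoint (ℂ × ℝ) ≃ₜ OnePoint (ℂ × ℝ) :=
    (Homeomorph.addLeft ((0 : ℂ), (1 : ℝ))).onePointCongr
  have he : ∀ w c, e ((w, c) : ℂ × ℝ) = ((w, 1 + c) : ℂ × ℝ) := fun w c => by
    change ((((0 : ℂ), (1 : ℝ)) + (w, c) : ℂ × ℝ) : OnePoint (ℂ × ℝ)) = _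
    simp
  have hesymm : ∀ w c, e.symm ((w, 1 + c) : ℂ × ℝ) = ((w, c) : ℂ × ℝ) := fun w c => by
    rw [← he, e.symm_apply_apply]
  have hei : e OnePoint.infty = OnePoint.infty := rfl
  have hne : ∀ (w : ℂ) (c : ℝ), -1 < c → ((w, 1 + c) : ℂ × ℝ) ≠ 0 := fun w c hc h => by
    have := (Prod.ext_iff.1 h).2
    simp only [Prod.snd_zero] at this
    linarith
  -- The pushed-up points `(s, 1)` have gauge 1 and are fixed by the inversion.
  have hfinal : ∀ s : ℝ, |s| ≤ 1 →
      e.symm (boxInvHomeo hη (V (((s : ℂ), |s|) : ℂ × ℝ))) = (((s : ℂ), (0 : ℝ)) : ℂ × ℝ) := by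
    intro s hs
    have h1 := hne (s : ℂ) 0 (by norm_num)
    have h2 := boxInv_of_gauge (η := η) (w := (s : ℂ)) (zero_le_one' ℝ) (by
      rw [Complex.norm_real, Real.norm_eq_abs, sq_abs]
      have := (sq_le_one_iff_abs_le_one s).2 hs
      nlinarith [sq_nonneg s])
    rw [hVs s hs, boxInvHomeo_apply]
    rw [add_zero] at h1
    rw [boxInvOnePoint_coe η h1, h2]
    have := hesymm (s : ℂ) 0
    simpa using this
  -- Straighten, then apply the push conjugated by the inversion and by the translation.
  refine ⟨g₁.trans ((e.symm.symm.trans (((boxInvHomeo hη).symm.trans V).trans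
    (boxInvHomeo hη))).trans e.symm), hg₁.trans ((hV.conj _).conj _), ?_, ?_, ?_, ?_⟩
  · intro t ht
    have hz := harc t ht
    have h1 : g₁ (γ t) = (γ t : OnePoint (ℂ × ℝ)) := by
      have := hg₁s (γ t).1 (γ t).2
      rw [hP0 _ hz, hQ0 _ hz] at this
      rw [Prod.mk.eta] at this
      rw [this]
      congr 1
      refine Prod.ext ?_ rfl
      simp only; ring
    simp only [Homeomorph.trans_apply, Homeomorph.symm_symm, h1]
    have h2 := he (γ t).1 (γ t).2
    rw [Prod.mk.eta] at h2
    have h0 := hne (γ t).1 (γ t).2 (hpos t)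
    rw [h2, boxInvHomeo_symm_apply, boxInvOnePoint_coe η h0, hqbox t ht,
      hVA _ ⟨t, ht, rfl⟩, ← hqbox t ht, ← boxInvOnePoint_coe η h0, boxInvHomeo_apply,
      boxInvOnePoint_involutive hη, hesymm]
  · intro t ht
    have hz : 0 ≤ (γ t).2 := by
      have := hmono.monotoneOn Set.self_mem_Ici ht ht
      simpa [hb] using this
    have h1 : g₁ (γ t) = (((1 : ℝ) : ℂ), (γ t).2) := by
      have := hg₁s (γ t).1 (γ t).2
      have hPt : P (γ t).2 = (γ t).1 := by
        change (γ (θ (γ t).2)).1 = _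
        rw [hθz t ht]
      rw [Prod.mk.eta] at this
      rw [this]
      congr 1
      refine Prod.ext ?_ rfl
      have := sub_ne_zero.2 (hPQ (γ t).2)
      rw [← hPt]
      simp only [Complex.ofReal_one]
      rw [div_eq_one_iff_eq this]
      ring
    have hs : |(1 + (γ t).2)⁻¹| = (1 + (γ t).2)⁻¹ := abs_of_nonneg (by positivity)
    have h0 := hne ((1 : ℝ) : ℂ) (γ t).2 (hpos t)
    have h3 := boxInv_of_gauge (η := η) (w := ((1 : ℝ) : ℂ)) (by linarith : 0 ≤ 1 + (γ t).2)
      (by simp; linarith)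
    have h4 := hfinal (1 + (γ t).2)⁻¹ (by rw [hs]; exact inv_le_one_of_one_le₀ (by linarith))
    rw [hs] at h4
    simp only [Homeomorph.trans_apply, Homeomorph.symm_symm, h1, he]
    rw [boxInvHomeo_symm_apply, boxInvOnePoint_coe η h0, h3, ← h4]
    congr 5
    push_cast
    simp
  · intro t ht
    have hz : 0 ≤ (γ t).2 := by
      have := hanti.antitoneOn ht Set.self_mem_Iic ht
      simpa [ha] using this
    have h1 : g₁ (γ t) = (((-1 : ℝ) : ℂ), (γ t).2) := by
      have := hg₁s (γ t).1 (γ t).2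
      have hQt : Q (γ t).2 = (γ t).1 := by
        change (γ (-θ' (γ t).2)).1 = _
        have := hθz' (-t) (neg_le_neg ht)
        rw [neg_neg] at this
        rw [this, neg_neg]
      rw [Prod.mk.eta] at this
      rw [this]
      congr 1
      refine Prod.ext ?_ rfl
      have := sub_ne_zero.2 (hPQ (γ t).2)
      rw [← hQt]
      simp only [Complex.ofReal_neg, Complex.ofReal_one]
      rw [div_eq_iff this]
      ring
    have hs : |-(1 + (γ t).2)⁻¹| = (1 + (γ t).2)⁻¹ := by
      rw [abs_neg]; exact abs_of_nonneg (by positivity)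
    have h0 := hne ((-1 : ℝ) : ℂ) (γ t).2 (hpos t)
    have h3 := boxInv_of_gauge (η := η) (w := ((-1 : ℝ) : ℂ)) (by linarith : 0 ≤ 1 + (γ t).2)
      (by simp; linarith)
    have h4 := hfinal (-(1 + (γ t).2)⁻¹) (by rw [hs]; exact inv_le_one_of_one_le₀ (by linarith))
    rw [hs] at h4
    simp only [Homeomorph.trans_apply, Homeomorph.symm_symm, h1, he]
    rw [boxInvHomeo_symm_apply, boxInvOnePoint_coe η h0, h3, ← h4]
    congr 5
    push_cast
    rw [neg_div, one_div]
  · simp only [Homeomorph.trans_apply, Homeomorph.symm_symm, hg₁i, hei]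
    rw [boxInvHomeo_symm_apply, boxInvOnePoint_infty]
    have h4 := hfinal 0 (by simp)
    rw [← h4]
    simp only [Complex.ofReal_zero, abs_zero, Prod.mk_zero_zero]

/-! ## Counting local maxima -/

theorem not_isLocalMax_of_strictAntiOn {f : ℝ → ℝ} {s : Set ℝ} (hf : StrictAntiOn f s) {t : ℝ}
    (ht : t ∈ s) (hs : s ∈ 𝓝[<] t) : ¬ IsLocalMax f t := by
  intro h
  obtain ⟨u, ⟨h1, h2⟩, h3⟩ :=
    (((h.filter_mono nhdsWithin_le_nhds : ∀ᶠ u in 𝓝[<] t, f u ≤ f t).and hs).and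
      self_mem_nhdsWithin).exists
  exact absurd h1 (not_le.2 (hf h2 ht h3))

theorem not_isLocalMax_of_strictMonoOn {f : ℝ → ℝ} {s : Set ℝ} (hf : StrictMonoOn f s) {t : ℝ}
    (ht : t ∈ s) (hs : s ∈ 𝓝[>] t) : ¬ IsLocalMax f t := by
  intro h
  obtain ⟨u, ⟨h1, h2⟩, h3⟩ :=
    (((h.filter_mono nhdsWithin_le_nhds : ∀ᶠ u in 𝓝[>] t, f u ≤ f t).and hs).and
      self_mem_nhdsWithin).exists
  exact absurd h1 (not_le.2 (hf ht h2 h3))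

theorem IsLocalMax.comp_coe {h : OnePoint ℝ → ℝ} {t : ℝ} (ht : IsLocalMax h (t : OnePoint ℝ)) :
    IsLocalMax (fun s : ℝ => h s) t :=
  (OnePoint.continuous_coe.tendsto t).eventually ht

/-- Between two local maxima of a polynomial on an interval there is a critical point. -/
theorem exists_derivative_eq_zero_between {P : Polynomial ℝ} {x y : ℝ} (hxy : x < y)
    (hx : ∀ᶠ s in 𝓝[>] x, P.eval s ≤ P.eval x) (hy : ∀ᶠ s in 𝓝[<] y, P.eval s ≤ P.eval y) :
    ∃ s ∈ Set.Ioo x y, P.derivative.eval s = 0 := by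
  obtain ⟨u, hu, hmin⟩ := (isCompact_Icc (a := x) (b := y)).exists_isMinOn
    (Set.nonempty_Icc.2 hxy.le) P.continuous.continuousOn
  -- A minimum over `[x, y]` at an endpoint is also attained inside, since values next to that
  -- endpoint do not exceed it.
  obtain ⟨s, hs, hsu⟩ : ∃ s ∈ Set.Ioo x y, P.eval s ≤ P.eval u := by
    rcases hu.1.eq_or_lt with rfl | h1
    · obtain ⟨s, h, h'⟩ := (hx.and (Ioo_mem_nhdsGT hxy)).exists
      exact ⟨s, h', h⟩
    rcases hu.2.eq_or_lt with rfl | h2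
    · obtain ⟨s, h, h'⟩ := (hy.and (Ioo_mem_nhdsLT hxy)).exists
      exact ⟨s, h', h⟩
    · exact ⟨u, ⟨h1, h2⟩, le_rfl⟩
  refine ⟨s, hs, ?_⟩
  rw [← P.deriv]
  apply IsLocalMin.deriv_eq_zero
  filter_upwards [Icc_mem_nhds hs.1 hs.2] with v hv
  exact hsu.trans (hmin hv)

theorem localMaxima_eq_component {X : Type*} [TopologicalSpace X] {h : X → ℝ} {C : Set X}
    (hC : C ∈ localMaxima h) {y : X} (hy : y ∈ C) : C = connectedComponentIn {p | h p = h y} y := by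
  obtain ⟨x, rfl, -⟩ := hC
  have : h y = h x := connectedComponentIn_subset {p | h p = h x} x hy
  rw [this]
  exact connectedComponentIn_eq hy

theorem localMaxima_superset {X : Type*} [TopologicalSpace X] {h : X → ℝ} {C : Set X}
    (hC : C ∈ localMaxima h) {y : X} (hy : y ∈ C) {A : Set X} (hA : IsPreconnected A) (hyA : y ∈ A)
    (hh : ∀ p ∈ A, h p = h y) : A ⊆ C := by
  rw [localMaxima_eq_component hC hy]
  exact hA.subset_connectedComponentIn hyA hh

theorem localMaxima_eq_of_mem {X : Type*} [TopologicalSpace X] {h : X → ℝ} {C C' : Set X}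
    (hC : C ∈ localMaxima h) (hC' : C' ∈ localMaxima h) {y : X} (hy : y ∈ C) (hy' : y ∈ C') :
    C = C' := by
  rw [localMaxima_eq_component hC hy, localMaxima_eq_component hC' hy']

/-- A set between a connected set and its closure is connected. -/
theorem isPreconnected_coe_image_insert_infty {s : Set ℝ} (hs : IsPreconnected s)
    (hinf : (OnePoint.infty : OnePoint ℝ) ∈ closure ((fun t : ℝ => (t : OnePoint ℝ)) '' s)) :
    IsPreconnected (insert OnePoint.infty ((fun t : ℝ => (t : OnePoint ℝ)) '' s)) :=
  (hs.image _ OnePoint.continuous_coe.continuousOn).subset_closure (Set.subset_insert _ _)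
    (Set.insert_subset hinf subset_closure)

theorem tendsto_coe_atTop : Tendsto (fun t : ℝ => (t : OnePoint ℝ)) atTop (𝓝 OnePoint.infty) :=
  OnePoint.tendsto_coe_infty.mono_left (by
    rw [coclosedCompact_eq_cocompact]; exact atTop_le_cocompact)

theorem tendsto_coe_atBot : Tendsto (fun t : ℝ => (t : OnePoint ℝ)) atBot (𝓝 OnePoint.infty) :=
  OnePoint.tendsto_coe_infty.mono_left (by
    rw [coclosedCompact_eq_cocompact]; exact atBot_le_cocompact)

/-- The two tails `[b, ∞)` and `(-∞, a]`, together with the point at infinity. -/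
theorem isPreconnected_tails (a b : ℝ) :
    IsPreconnected (insert OnePoint.infty ((fun t : ℝ => (t : OnePoint ℝ)) '' Set.Ici b) ∪
      insert OnePoint.infty ((fun t : ℝ => (t : OnePoint ℝ)) '' Set.Iic a)) := by
  refine IsPreconnected.union OnePoint.infty (Set.mem_insert _ _) (Set.mem_insert _ _) ?_ ?_
  · refine isPreconnected_coe_image_insert_infty isPreconnected_Ici
      (mem_closure_of_tendsto tendsto_coe_atTop ?_)
    filter_upwards [eventually_ge_atTop b] with t ht using ⟨t, ht, rfl⟩
  · refine isPreconnected_coe_image_insert_infty isPreconnected_Iic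
      (mem_closure_of_tendsto tendsto_coe_atBot ?_)
    filter_upwards [eventually_le_atBot a] with t ht using ⟨t, ht, rfl⟩

/-- A function on the circle that is a polynomial of degree at most `2 m` on an arc, and monotone
on the complementary arc, has at most `m` local maxima. -/
theorem encard_localMaxima_le {h : OnePoint ℝ → ℝ} {P : Polynomial ℝ} {m : ℕ} (hm : 1 ≤ m)
    (hdeg : P.natDegree ≤ 2 * m) {a b : ℝ} {l : ℝ → ℝ} {u v : ℝ}
    (harc : ∀ t ∈ Set.Icc a b, h t = P.eval t)
    (hright : ∀ t, b ≤ t → h t = u + v * l t) (hleft : ∀ t, t ≤ a → h t = u + v * l t)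
    (hinf : h OnePoint.infty = u) (hl : StrictAntiOn l (Set.Ici b)) (hl' : StrictAntiOn l (Set.Iic a))
    (hlb : ∀ t, b ≤ t → 0 < l t) (hla : ∀ t, t ≤ a → l t < 0) (hab : a < b) :
    (localMaxima h).encard ≤ m := by
  set A : Set (OnePoint ℝ) := insert OnePoint.infty ((fun t : ℝ => (t : OnePoint ℝ)) '' Set.Ici b) ∪
      insert OnePoint.infty ((fun t : ℝ => (t : OnePoint ℝ)) '' Set.Iic a) with hA
  have hAc : IsPreconnected A := isPreconnected_tails a b
  have hbA : (b : OnePoint ℝ) ∈ A := Or.inl (Or.inr ⟨b, Set.self_mem_Ici, rfl⟩)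
  have haA : (a : OnePoint ℝ) ∈ A := Or.inr (Or.inr ⟨a, Set.self_mem_Iic, rfl⟩)
  have hcases : ∀ x : OnePoint ℝ, x ∈ A ∨ ∃ t ∈ Set.Icc a b, x = (t : OnePoint ℝ) := by
    intro x
    induction x using OnePoint.rec with
    | infty => exact Or.inl (Or.inl (Or.inl rfl))
    | coe t =>
      rcases le_total b t with h1 | h1
      · exact Or.inl (Or.inl (Or.inr ⟨t, h1, rfl⟩))
      rcases le_total t a with h2 | h2
      · exact Or.inl (Or.inr (Or.inr ⟨t, h2, rfl⟩))
      · exact Or.inr ⟨t, ⟨h2, h1⟩, rfl⟩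
  have hflat : v = 0 → ∀ p ∈ A, h p = u := by
    rintro rfl p ((rfl | ⟨t, ht, rfl⟩) | (rfl | ⟨t, ht, rfl⟩))
    · exact hinf
    · simp [hright t ht]
    · exact hinf
    · simp [hleft t ht]
  -- Going from `b` through `∞` to `a`, `l` decreases from positive to negative values. So the
  -- height is constant there, or strictly monotone with its only possible local maximum at the
  -- higher end.
  have hmax : ∀ x ∈ A, IsLocalMax h x →
      v = 0 ∨ (x = (b : OnePoint ℝ) ∧ 0 < v) ∨ (x = (a : OnePoint ℝ) ∧ v < 0) := by
    intro x hx hxm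
    rcases lt_trichotomy v 0 with hv | hv | hv
    · have m1 : StrictMonoOn (fun t : ℝ => h t) (Set.Ici b) := fun s hs t ht hst => by
        simp only [hright s hs, hright t ht]
        linarith [mul_lt_mul_of_neg_left (hl hs ht hst) hv]
      have m2 : StrictMonoOn (fun t : ℝ => h t) (Set.Iic a) := fun s hs t ht hst => by
        simp only [hleft s hs, hleft t ht]
        linarith [mul_lt_mul_of_neg_left (hl' hs ht hst) hv]
      have hi : ¬ IsLocalMax h OnePoint.infty := fun hm => by
        obtain ⟨t, h1, h2⟩ := ((tendsto_coe_atBot.eventually hm).and (eventually_le_atBot a)).exists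
        rw [hinf, hleft t h2] at h1
        linarith [mul_pos_of_neg_of_neg hv (hla t h2)]
      rcases hx with (rfl | ⟨t, ht, rfl⟩) | (rfl | ⟨t, ht, rfl⟩)
      · exact absurd hxm hi
      · exact absurd hxm.comp_coe (not_isLocalMax_of_strictMonoOn m1 ht
          (mem_of_superset self_mem_nhdsWithin fun s hs => Set.mem_Ici.2 (le_trans ht (le_of_lt hs))))
      · exact absurd hxm hi
      · rcases (Set.mem_Iic.1 ht).eq_or_lt with rfl | h1
        · exact Or.inr (Or.inr ⟨rfl, hv⟩)
        · exact absurd hxm.comp_coe (not_isLocalMax_of_strictMonoOn m2 ht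
            (mem_nhdsWithin_of_mem_nhds (Iic_mem_nhds h1)))
    · exact Or.inl hv
    · have m1 : StrictAntiOn (fun t : ℝ => h t) (Set.Ici b) := fun s hs t ht hst => by
        simp only [hright s hs, hright t ht]
        linarith [mul_lt_mul_of_pos_left (hl hs ht hst) hv]
      have m2 : StrictAntiOn (fun t : ℝ => h t) (Set.Iic a) := fun s hs t ht hst => by
        simp only [hleft s hs, hleft t ht]
        linarith [mul_lt_mul_of_pos_left (hl' hs ht hst) hv]
      have hi : ¬ IsLocalMax h OnePoint.infty := fun hm => by
        obtain ⟨t, h1, h2⟩ := ((tendsto_coe_atTop.eventually hm).and (eventually_ge_atTop b)).exists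
        rw [hinf, hright t h2] at h1
        linarith [mul_pos hv (hlb t h2)]
      rcases hx with (rfl | ⟨t, ht, rfl⟩) | (rfl | ⟨t, ht, rfl⟩)
      · exact absurd hxm hi
      · rcases (Set.mem_Ici.1 ht).eq_or_lt with rfl | h1
        · exact Or.inr (Or.inl ⟨rfl, hv⟩)
        · exact absurd hxm.comp_coe (not_isLocalMax_of_strictAntiOn m1 ht
            (mem_nhdsWithin_of_mem_nhds (Ici_mem_nhds h1)))
      · exact absurd hxm hi
      · exact absurd hxm.comp_coe (not_isLocalMax_of_strictAntiOn m2 ht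
          (mem_of_superset self_mem_nhdsWithin fun s hs => Set.mem_Iic.2 (le_trans (le_of_lt hs) ht)))
  have hloc : ∀ C ∈ localMaxima h, ∀ y ∈ C, IsLocalMax h y := by
    rintro C ⟨x, -, hx⟩
    exact hx
  -- A maximum meeting the tails is located at an end of the arc, or is a plateau that contains the
  -- tails entirely, hence `b`.
  have hrep : ∀ C ∈ localMaxima h, ∃ t : ℝ, t ∈ Set.Icc a b ∧ (t : OnePoint ℝ) ∈ C := by
    intro C hC
    have hne : C.Nonempty := by
      obtain ⟨x, rfl, -⟩ := hC
      exact ⟨x, mem_connectedComponentIn rfl⟩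
    obtain ⟨x, hx⟩ := hne
    rcases hcases x with h1 | ⟨t, ht, rfl⟩
    · rcases hmax x h1 (hloc C hC x hx) with hv | ⟨rfl, -⟩ | ⟨rfl, -⟩
      · exact ⟨b, ⟨hab.le, le_rfl⟩, localMaxima_superset hC hx hAc h1
          (fun p hp => (hflat hv p hp).trans (hflat hv x h1).symm) hbA⟩
      · exact ⟨b, ⟨hab.le, le_rfl⟩, hx⟩
      · exact ⟨a, ⟨le_rfl, hab.le⟩, hx⟩
    · exact ⟨t, ht, hx⟩
  have hends : ∀ C ∈ localMaxima h, ∀ C' ∈ localMaxima h, (a : OnePoint ℝ) ∈ C →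
      (b : OnePoint ℝ) ∈ C' → C = C' := by
    intro C hC C' hC' ha hb
    have key : v = 0 := by
      rcases hmax _ haA (hloc C hC _ ha) with h1 | ⟨h1, -⟩ | ⟨-, h1⟩
      · exact h1
      · exact absurd (OnePoint.coe_injective h1) hab.ne
      rcases hmax _ hbA (hloc C' hC' _ hb) with h2 | ⟨-, h2⟩ | ⟨h2, -⟩
      · exact h2
      · exact absurd h1 h2.not_gt
      · exact absurd (OnePoint.coe_injective h2) hab.ne'
    exact localMaxima_eq_of_mem hC hC' (localMaxima_superset hC ha hAc haA
      (fun p hp => (hflat key p hp).trans (hflat key _ haA).symm) hbA) hb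
  -- If `P` is constant, so is the height on the whole circle: there is a single plateau, and `1 ≤
  -- m`.
  by_cases hP : P.derivative = 0
  · obtain ⟨c, rfl⟩ : ∃ c, P = Polynomial.C c :=
      ⟨_, Polynomial.eq_C_of_natDegree_eq_zero (Polynomial.derivative_eq_zero.1 hP)⟩
    have e1 := harc a ⟨le_rfl, hab.le⟩
    have e2 := harc b ⟨hab.le, le_rfl⟩
    rw [Polynomial.eval_C] at e1 e2
    have hv : v = 0 := by
      rw [hleft a le_rfl] at e1
      rw [hright b le_rfl] at e2
      have h1 : v * (l b - l a) = 0 := by linarith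
      rcases mul_eq_zero.1 h1 with h2 | h2
      · exact h2
      · linarith [hlb b le_rfl, hla a le_rfl]
    have hconst : ∀ x, h x = c := by
      intro x
      rcases hcases x with h1 | ⟨t, ht, rfl⟩
      · rw [hflat hv x h1, ← hflat hv _ haA, e1]
      · rw [harc t ht, Polynomial.eval_C]
    have hsub : localMaxima h ⊆ {Set.univ} := by
      rintro C hC
      obtain ⟨t, -, ht⟩ := hrep C hC
      exact Set.univ_subset_iff.1 (localMaxima_superset hC ht isPreconnected_univ (Set.mem_univ _)
        fun p _ => (hconst p).trans (hconst _).symm)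
    refine (Set.encard_le_encard hsub).trans ?_
    rw [Set.encard_singleton]
    exact_mod_cast hm
  choose! ρ hρI hρC using hrep
  have hρinj : Set.InjOn ρ (localMaxima h) := fun C hC C' hC' e =>
    localMaxima_eq_of_mem hC hC' (hρC C hC) (e ▸ hρC C' hC')
  set T := P.derivative.roots.toFinset with hT
  have hTmem : ∀ t, t ∈ T ↔ P.derivative.eval t = 0 := fun t => by
    rw [hT, Multiset.mem_toFinset, Polynomial.mem_roots hP, Polynomial.IsRoot]
  have hTcard : T.card ≤ 2 * m - 1 :=
    (Multiset.toFinset_card_le _).trans ((Polynomial.card_roots' _).trans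
      ((Polynomial.natDegree_derivative_le P).trans (Nat.sub_le_sub_right hdeg 1)))
  have hrel : ∀ C ∈ localMaxima h, ∀ᶠ s in 𝓝 (ρ C), s ∈ Set.Icc a b →
      P.eval s ≤ P.eval (ρ C) := by
    intro C hC
    filter_upwards [(hloc C hC _ (hρC C hC)).comp_coe] with s hs hsI
    rwa [harc s hsI, harc _ (hρI C hC)] at hs
  have hint : ∀ C ∈ localMaxima h, ρ C ∉ T → ρ C = a ∨ ρ C = b := by
    intro C hC hn
    by_contra! hne
    have hI : ρ C ∈ Set.Ioo a b :=
      ⟨lt_of_le_of_ne (hρI C hC).1 hne.1.symm, lt_of_le_of_ne (hρI C hC).2 hne.2⟩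
    refine hn ((hTmem _).2 ?_)
    rw [← P.deriv]
    apply IsLocalMax.deriv_eq_zero
    filter_upwards [hrel C hC, Icc_mem_nhds hI.1 hI.2] with s h1 h2 using h1 h2
  have hfin : (ρ '' localMaxima h).Finite := by
    refine (T.finite_toSet.union (Set.toFinite {a, b})).subset ?_
    rintro - ⟨C, hC, rfl⟩
    by_cases hn : ρ C ∈ T
    · exact Or.inl hn
    · exact Or.inr (hint C hC hn)
  rw [← hρinj.encard_image, hfin.encard_eq_coe_toFinset_card, Nat.cast_le]
  set S := hfin.toFinset with hS
  have hSmem : ∀ t ∈ S, ∃ C ∈ localMaxima h, ρ C = t := fun t ht => (hfin.mem_toFinset).1 ht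
  -- Consecutive representatives are separated by a critical point, which is not itself a
  -- representative.
  have c1 : S.card ≤ (T \ S).card + 1 := by
    refine Finset.card_le_sdiff_of_interleaved fun x hx y hy hxy _ => ?_
    obtain ⟨C, hC, rfl⟩ := hSmem x hx
    obtain ⟨C', hC', rfl⟩ := hSmem y hy
    have hx' := hρI C hC
    have hy' := hρI C' hC'
    obtain ⟨s, hs, hs'⟩ := exists_derivative_eq_zero_between (P := P) hxy
      (by
        filter_upwards [nhdsWithin_le_nhds (hrel C hC), Ioo_mem_nhdsGT hxy] with s h1 h2
        exact h1 ⟨hx'.1.trans h2.1.le, h2.2.le.trans hy'.2⟩)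
      (by
        filter_upwards [nhdsWithin_le_nhds (hrel C' hC'), Ioo_mem_nhdsLT hxy] with s h1 h2
        exact h1 ⟨hx'.1.trans h2.1.le, h2.2.le.trans hy'.2⟩)
    exact ⟨s, (hTmem s).2 hs', hs.1, hs.2⟩
  -- A noncritical representative is an end of the arc, and by `hends` the two ends cannot represent
  -- different maxima.
  have c2 : (S \ T).card ≤ 1 := by
    rw [Finset.card_le_one]
    have key : ∀ C ∈ localMaxima h, ∀ C' ∈ localMaxima h, ρ C = a → ρ C' = b → ρ C = ρ C' := by
      intro C hC C' hC' ha hb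
      rw [hends C hC C' hC' (ha ▸ hρC C hC) (hb ▸ hρC C' hC')]
    intro x hx y hy
    rw [Finset.mem_sdiff] at hx hy
    obtain ⟨C, hC, rfl⟩ := hSmem x hx.1
    obtain ⟨C', hC', rfl⟩ := hSmem y hy.1
    rcases hint C hC hx.2 with h1 | h1 <;> rcases hint C' hC' hy.2 with h2 | h2
    · rw [h1, h2]
    · exact key C hC C' hC' h1 h2
    · exact (key C' hC' C hC h2 h1).symm
    · rw [h1, h2]
  have c3 := Finset.card_sdiff_add_card_inter S T
  have c4 := Finset.card_sdiff_add_card_inter T S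
  rw [Finset.inter_comm] at c4
  -- Adding up, `2 |S| ≤ |T \ S| + 1 + |S ∩ T| + 1 = |T| + 2 ≤ 2m + 1`.
  omega

/-! ## The tails of a polynomial -/

theorem Polynomial.exists_strictMonoOn_Ici {q : Polynomial ℝ} (hd : 0 < q.natDegree)
    (hl : 0 < q.leadingCoeff) : ∃ T : ℝ, StrictMonoOn (fun t => q.eval t) (Set.Ici T) := by
  have hev : ∀ᶠ t in atTop, 0 < q.derivative.eval t := by
    have hl' : 0 < q.derivative.leadingCoeff := by
      rw [Polynomial.leadingCoeff, Polynomial.natDegree_derivative, Polynomial.coeff_derivative,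
        Nat.sub_add_cancel hd]
      exact mul_pos hl (by positivity)
    rcases Nat.eq_zero_or_pos q.derivative.natDegree with h | h
    · rw [Polynomial.eq_C_of_natDegree_eq_zero h] at hl' ⊢
      filter_upwards with t
      simpa using hl'
    · exact (Polynomial.tendsto_atTop_of_leadingCoeff_nonneg _
        (Polynomial.natDegree_pos_iff_degree_pos.1 h) hl'.le).eventually_gt_atTop 0
  obtain ⟨T, hT⟩ := eventually_atTop.1 hev
  refine ⟨T, strictMonoOn_of_deriv_pos (convex_Ici T) q.continuous.continuousOn fun t ht => ?_⟩
  rw [q.deriv]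
  rw [interior_Ici] at ht
  exact hT t (le_of_lt ht)

theorem Polynomial.tendsto_eval_atTop {q : Polynomial ℝ} (hd : 0 < q.natDegree)
    (hl : 0 < q.leadingCoeff) : Tendsto (fun t => q.eval t) atTop atTop :=
  q.tendsto_atTop_of_leadingCoeff_nonneg (Polynomial.natDegree_pos_iff_degree_pos.1 hd) hl.le

theorem Polynomial.leadingCoeff_comp_neg (q : Polynomial ℝ) :
    (q.comp (-Polynomial.X)).leadingCoeff = q.leadingCoeff * (-1) ^ q.natDegree := by
  rw [Polynomial.leadingCoeff_comp (by simp)]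
  simp

theorem Polynomial.natDegree_comp_neg (q : Polynomial ℝ) :
    (q.comp (-Polynomial.X)).natDegree = q.natDegree := by
  rw [Polynomial.natDegree_comp]; simp

/-- A continuous function that increases to infinity on a half line reaches there a value that
exceeds a given bound. -/
theorem exists_ge_eq_of_tendsto_atTop {f : ℝ → ℝ} (hf : Continuous f) (ht : Tendsto f atTop atTop)
    {T Z : ℝ} (h : f T < Z) : ∃ b, T < b ∧ f b = Z := by
  obtain ⟨s, h1, h2⟩ := ((ht.eventually_ge_atTop Z).and (eventually_ge_atTop T)).exists
  obtain ⟨b, hb, hbZ⟩ := intermediate_value_Icc h2 hf.continuousOn ⟨h.le, h1⟩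
  refine ⟨b, lt_of_le_of_ne hb.1 ?_, hbZ⟩
  rintro rfl
  exact h.ne hbZ

/-- The shape of the graph of a polynomial of even degree. -/
theorem Polynomial.exists_arc_of_even {q : Polynomial ℝ} (hd : 0 < q.natDegree)
    (he : Even q.natDegree) (hl : 0 < q.leadingCoeff) :
    ∃ a b : ℝ, a < b ∧ q.eval a = q.eval b ∧ (∀ t ∈ Set.Ioo a b, q.eval t < q.eval b) ∧
      StrictAntiOn (fun t => q.eval t) (Set.Iic a) ∧ StrictMonoOn (fun t => q.eval t) (Set.Ici b) ∧
      Tendsto (fun t => q.eval t) atTop atTop ∧ Tendsto (fun t => q.eval t) atBot atTop := by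
  have hd' : 0 < (q.comp (-Polynomial.X)).natDegree := by rwa [q.natDegree_comp_neg]
  have hl' : 0 < (q.comp (-Polynomial.X)).leadingCoeff := by
    rwa [q.leadingCoeff_comp_neg, he.neg_one_pow, mul_one]
  obtain ⟨T, hT⟩ := Polynomial.exists_strictMonoOn_Ici hd hl
  obtain ⟨T', hT'⟩ := Polynomial.exists_strictMonoOn_Ici hd' hl'
  have t1 := Polynomial.tendsto_eval_atTop hd hl
  have t2 := Polynomial.tendsto_eval_atTop hd' hl'
  simp only [Polynomial.eval_comp, Polynomial.eval_neg, Polynomial.eval_X] at hT' t2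
  -- Both tails are monotone beyond `S`, and the level `B + 1` exceeds `q` on `[-S, S]`, so it is
  -- reached only on the tails. The left end of the arc will be `-a`.
  set S := max (max T T') 1
  have hTS : T ≤ S := (le_max_left T T').trans (le_max_left _ _)
  have hTS' : T' ≤ S := (le_max_right T T').trans (le_max_left _ _)
  have hS1 : 1 ≤ S := le_max_right _ _
  obtain ⟨B, hB⟩ := (isCompact_Icc (a := -S) (b := S)).exists_bound_of_continuousOn
    q.continuous.continuousOn
  have hZ : ∀ t ∈ Set.Icc (-S) S, q.eval t < B + 1 := fun t ht => by
    have := (le_abs_self _).trans (hB t ht)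
    linarith
  obtain ⟨b, hb, hbZ⟩ := exists_ge_eq_of_tendsto_atTop q.continuous t1
    (hZ S ⟨by linarith, le_rfl⟩)
  obtain ⟨a, ha, haZ⟩ := exists_ge_eq_of_tendsto_atTop (f := fun t => q.eval (-t)) (by fun_prop) t2
    (hZ (-S) ⟨le_rfl, by linarith⟩)
  refine ⟨-a, b, by linarith, haZ.trans hbZ.symm, ?_, ?_, ?_, t1, ?_⟩
  · intro t ht
    rw [hbZ]
    rcases le_total S t with h | h
    · rw [← hbZ]
      exact hT (Set.mem_Ici.2 (hTS.trans h)) (Set.mem_Ici.2 (hTS.trans hb.le)) ht.2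
    rcases le_total t (-S) with h' | h'
    · rw [← haZ]
      have := hT' (a := -t) (b := a) (Set.mem_Ici.2 (by linarith)) (Set.mem_Ici.2 (by linarith))
        (by linarith [ht.1])
      simpa using this
    · exact hZ t ⟨h', h⟩
  · intro s hs t ht hst
    have hs' := Set.mem_Iic.1 hs
    have ht' := Set.mem_Iic.1 ht
    have := hT' (a := -t) (b := -s) (Set.mem_Ici.2 (by linarith)) (Set.mem_Ici.2 (by linarith))
      (by linarith)
    simpa using this
  · exact hT.mono (Set.Ici_subset_Ici.2 (by linarith))
  · have := t2.comp tendsto_neg_atBot_atTop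
    simpa [Function.comp_def] using this

/-! ## Affine coordinates -/

/-- Coordinates on `ℝ³` with values in `ℂ × ℝ`, whose last component is the `i`-th coordinate. -/
noncomputable def splitCoord (i : Fin 3) : Euc 3 ≃ₗ[ℝ] ℂ × ℝ where
  toFun x := (⟨x (i + 1), x (i + 2)⟩, x i)
  map_add' x y := by refine Prod.ext (Complex.ext ?_ ?_) ?_ <;> simp
  map_smul' r x := by refine Prod.ext (Complex.ext ?_ ?_) ?_ <;> simp
  invFun p := WithLp.toLp 2 fun j => if j = i then p.2 else if j = i + 1 then p.1.re else p.1.im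
  left_inv x := by
    ext j
    fin_cases i <;> fin_cases j <;> rfl
  right_inv p := by
    refine Prod.ext (Complex.ext ?_ ?_) ?_ <;> fin_cases i <;> rfl

/-- Being at the same level, distinct points have distinct projections to `ℂ`, and a complex affine
map takes these to `∓1`. Since the model is affine, the segment built in it is a straight chord of
`ℝ³`. -/
theorem exists_affine_model {x y : Euc 3} (hxy : x ≠ y) {i : Fin 3} {ζ s : ℝ} (hx : x i = ζ)
    (hy : y i = ζ) (hs : s ≠ 0) :
    ∃ E : Euc 3 ≃ₜ ℂ × ℝ, E x = (-1, 0) ∧ E y = (1, 0) ∧ (∀ z, (E z).2 = s * (z i - ζ)) ∧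
      ∀ l : ℝ, E.symm ((l : ℂ), (0 : ℝ)) = (1 / 2 : ℝ) • (x + y) + l • (1 / 2 : ℝ) • (y - x) := by
  let L : Euc 3 ≃L[ℝ] ℂ × ℝ := (splitCoord i).toContinuousLinearEquiv
  have hL2 : ∀ z, (L z).2 = z i := fun z => rfl
  have hne : (L y).1 - (L x).1 ≠ 0 := by
    intro h
    apply hxy
    apply L.injective
    refine Prod.ext (sub_eq_zero.1 h).symm ?_
    rw [hL2, hL2, hx, hy]
  have hne2 : ((L y).1 - (L x).1) / 2 ≠ 0 := div_ne_zero hne two_ne_zero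
  let E : Euc 3 ≃ₜ ℂ × ℝ := L.toHomeomorph.trans (Homeomorph.prodCongr
    ((Homeomorph.subRight (((L x).1 + (L y).1) / 2)).trans (Homeomorph.mulRight₀ _ (inv_ne_zero hne2)))
    ((Homeomorph.subRight ζ).trans (Homeomorph.mulLeft₀ s hs)))
  have hE : ∀ z, E z = (((L z).1 - ((L x).1 + (L y).1) / 2) * (((L y).1 - (L x).1) / 2)⁻¹,
      s * ((L z).2 - ζ)) := fun z => rfl
  refine ⟨E, ?_, ?_, fun z => ?_, fun l => ?_⟩
  · rw [hE, hL2, hx]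
    refine Prod.ext ?_ (by simp)
    simp only
    field_simp
    ring
  · rw [hE, hL2, hy]
    refine Prod.ext ?_ (by simp)
    simp only
    field_simp
    ring
  · rw [hE, hL2]
  · rw [E.symm_apply_eq, hE]
    refine Prod.ext ?_ ?_
    · simp only [map_add, map_smul, map_sub, Prod.fst_add, Prod.smul_fst, Prod.fst_sub,
        Complex.real_smul]
      push_cast
      field_simp
      ring
    · rw [hL2]
      simp [hx, hy]
      right; ring

/-! ## Long knots with a coordinate of even degree -/

/-- A long knot whose components are polynomials of degree at most `2 m`, one of them of degree
`2 m`, has superbridge number at most `m`. -/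
theorem superbridgeNumber_le_of_even {α : TopologicalKnot 3} {p : Fin 3 → Polynomial ℝ}
    (hα : ∀ t : ℝ, α.toMap t = ((WithLp.toLp 2 fun j => (p j).eval t : Euc 3) : OnePoint (Euc 3)))
    (hαi : α.toMap OnePoint.infty = OnePoint.infty) {m : ℕ} (hm : 1 ≤ m)
    (hdeg : ∀ j, (p j).natDegree ≤ 2 * m) {i : Fin 3} (hi : (p i).natDegree = 2 * m) :
    superbridgeNumber α ≤ m := by
  let κ : ℝ → Euc 3 := fun t => WithLp.toLp 2 fun j => (p j).eval t
  have hκi : ∀ t j, κ t j = (p j).eval t := fun t j => rfl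
  have hκ : ∀ t : ℝ, α.toMap t = (κ t : OnePoint (Euc 3)) := hα
  have hκc : Continuous κ :=
    (PiLp.continuous_toLp 2 _).comp (continuous_pi fun j => (p j).continuous)
  have hκinj : Function.Injective κ := fun s t h => by
    have : α.toMap s = α.toMap t := by rw [hκ, hκ, h]
    exact OnePoint.coe_injective (α.injective this)
  obtain ⟨σ, hσ, hlead⟩ : ∃ σ : ℝ, σ * σ = 1 ∧ 0 < (Polynomial.C σ * p i).leadingCoeff := by
    have h0 : (p i).leadingCoeff ≠ 0 := by
      rw [Polynomial.leadingCoeff_ne_zero]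
      rintro h
      rw [h, Polynomial.natDegree_zero] at hi
      omega
    rcases lt_or_gt_of_ne h0 with h | h
    · exact ⟨-1, by norm_num, by
        rw [Polynomial.leadingCoeff_mul, Polynomial.leadingCoeff_C]; linarith⟩
    · exact ⟨1, by norm_num, by simpa using h⟩
  have hσ0 : σ ≠ 0 := by rintro rfl; simp at hσ
  set q := Polynomial.C σ * p i with hq
  have hqd : q.natDegree = 2 * m := by rw [hq, Polynomial.natDegree_C_mul hσ0, hi]
  have hqe : ∀ t, q.eval t = σ * (p i).eval t := fun t => by simp [hq]
  obtain ⟨a, b, hab, hZ, hneg, hanti, hmono, htop, hbot⟩ := Polynomial.exists_arc_of_even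
    (q := q) (by omega) (hqd ▸ even_two_mul m) hlead
  obtain ⟨t₀, -, ht₀⟩ := (isCompact_Icc (a := a) (b := b)).exists_isMinOn
    (Set.nonempty_Icc.2 hab.le) q.continuous.continuousOn
  have hmin : ∀ t, q.eval t₀ ≤ q.eval t := by
    intro t
    have hb := ht₀ (Set.right_mem_Icc.2 hab.le)
    have ha := ht₀ (Set.left_mem_Icc.2 hab.le)
    rcases le_total b t with h | h
    · exact hb.trans (hmono.monotoneOn Set.self_mem_Ici h h)
    rcases le_total t a with h' | h'
    · exact ha.trans (hanti.antitoneOn h' Set.self_mem_Iic h')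
    · exact ht₀ ⟨h', h⟩
  set Z := q.eval b
  -- Dividing heights by `M`, which exceeds the depth of the arc below level `Z`, keeps them above
  -- `-1`.
  have hM : 0 < Z - q.eval t₀ + 1 := by linarith [hmin b]
  set M := Z - q.eval t₀ + 1
  obtain ⟨E, hEa, hEb, hE2, hEsymm⟩ := exists_affine_model (x := κ a) (y := κ b) (i := i)
    (ζ := σ * Z) (s := σ / M) (fun h => hab.ne (hκinj h))
    (by rw [hκi, ← hZ, hqe, ← mul_assoc, hσ, one_mul])
    (by rw [hκi]; change _ = σ * q.eval b; rw [hqe, ← mul_assoc, hσ, one_mul])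
    (div_ne_zero hσ0 hM.ne')
  have hz : ∀ t, (E (κ t)).2 = (q.eval t - Z) / M := fun t => by
    rw [hE2, hκi, hqe]
    field_simp
    linear_combination (-Z) * hσ
  have hz_lt : ∀ s t, (E (κ s)).2 < (E (κ t)).2 ↔ q.eval s < q.eval t := fun s t => by
    rw [hz, hz, div_lt_div_iff_of_pos_right hM, sub_lt_sub_iff_right]
  have hposz : ∀ t, -1 < (E (κ t)).2 := fun t => by
    rw [hz, lt_div_iff₀ hM]
    have := hmin t
    simp only [M]
    linarith
  have htend : ∀ l : Filter ℝ, Tendsto (fun t => q.eval t) l atTop →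
      Tendsto (fun t => (E (κ t)).2) l atTop := fun l h => by
    simp only [hz, sub_eq_add_neg]
    exact (tendsto_atTop_add_const_right l _ h).atTop_div_const hM
  have hanti' : StrictAntiOn (fun t => (E (κ t)).2) (Set.Iic a) :=
    fun s hs t ht hst => (hz_lt _ _).2 (hanti hs ht hst)
  have hmono' : StrictMonoOn (fun t => (E (κ t)).2) (Set.Ici b) :=
    fun s hs t ht hst => (hz_lt _ _).2 (hmono hs ht hst)
  obtain ⟨g, hg, garc, gright, gleft, ginf⟩ := exists_close_by_segment (γ := fun t => E (κ t))
    (E.continuous.comp hκc) (E.injective.comp hκinj) hab hEa hEb hposz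
    (fun t ht => by
      rw [hz]; exact div_neg_of_neg_of_pos (sub_neg.2 (hneg t ht)) hM)
    hanti' hmono' (htend _ htop) (htend _ hbot)
  let e : OnePoint (Euc 3) ≃ₜ OnePoint (ℂ × ℝ) := E.onePointCongr
  have he : ∀ x : Euc 3, e x = (E x : OnePoint (ℂ × ℝ)) := fun x => rfl
  have hes : ∀ x : ℂ × ℝ, e.symm x = (E.symm x : OnePoint (Euc 3)) := fun x => rfl
  have hei : e OnePoint.infty = OnePoint.infty := rfl
  have hG := hg.conj e.symm
  set G : OnePoint (Euc 3) ≃ₜ OnePoint (Euc 3) := (e.symm.symm.trans g).trans e.symm with hGdef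
  have hGa : ∀ x, G x = e.symm (g (e x)) := fun x => rfl
  -- The position on the chord reached by a tail point; values strictly between `a` and `b` play no
  -- role.
  let l : ℝ → ℝ := fun t =>
    if t ≤ a then -(1 + (E (κ t)).2)⁻¹ else (1 + (E (κ t)).2)⁻¹
  have hlb : ∀ t, b ≤ t → l t = (1 + (E (κ t)).2)⁻¹ := fun t ht =>
    if_neg (not_le.2 (hab.trans_le ht))
  have hla : ∀ t, t ≤ a → l t = -(1 + (E (κ t)).2)⁻¹ := fun t ht => if_pos ht
  have hKarc : ∀ t ∈ Set.Icc a b, G (α.toMap t) = (κ t : OnePoint (Euc 3)) := fun t ht => by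
    rw [hGa, hκ, he, garc t ht, hes, E.symm_apply_apply]
  have hKr : ∀ t : ℝ, b ≤ t → G (α.toMap t) = (E.symm ((l t : ℂ), (0 : ℝ)) : OnePoint (Euc 3)) :=
    fun t ht => by rw [hGa, hκ, he, gright t ht, hes, hlb t ht]
  have hKl : ∀ t : ℝ, t ≤ a → G (α.toMap t) = (E.symm ((l t : ℂ), (0 : ℝ)) : OnePoint (Euc 3)) :=
    fun t ht => by rw [hGa, hκ, he, gleft t ht, hes, hla t ht]
  have hKi : G (α.toMap OnePoint.infty) =
      (E.symm (((0 : ℝ) : ℂ), (0 : ℝ)) : OnePoint (Euc 3)) := by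
    rw [hGa, hαi, hei, ginf, hes]
  have hK : ∀ x : OnePoint ℝ, ∃ y : Euc 3, G (α.toMap x) = (y : OnePoint (Euc 3)) := by
    intro x
    induction x using OnePoint.rec with
    | infty => exact ⟨_, hKi⟩
    | coe t =>
      rcases le_total b t with h1 | h1
      · exact ⟨_, hKr t h1⟩
      rcases le_total t a with h2 | h2
      · exact ⟨_, hKl t h2⟩
      · exact ⟨_, hKarc t ⟨h2, h1⟩⟩
  choose k hk using hK
  have hkc : Continuous k := by
    rw [OnePoint.isOpenEmbedding_coe.isInducing.continuous_iff]
    exact (G.continuous.comp α.toMap.continuous).congr hk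
  have hkinj : Function.Injective k := fun x y h =>
    α.injective (G.injective (by rw [hk, hk, h]))
  have hkeq : ∀ {x : OnePoint ℝ} {y : Euc 3}, G (α.toMap x) = (y : OnePoint (Euc 3)) → k x = y :=
    fun {x y} h => OnePoint.coe_injective ((hk x).symm.trans h)
  let K : EuclideanKnot 3 := ⟨⟨k, hkc⟩, hkinj⟩
  have hsame : SameKnotType K.toTopologicalKnot α :=
    ⟨Homeomorph.refl _, G, IsOrientationPreserving.refl, hG, fun x => (hk x).symm⟩
  refine iInf₂_le_of_le K hsame (iSup₂_le fun v _ => ?_)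
  have hinner : ∀ t, inner ℝ v (κ t) = (∑ j, Polynomial.C (v j) * p j).eval t := fun t => by
    rw [PiLp.inner_apply, Polynomial.eval_finsetSum]
    refine Finset.sum_congr rfl fun j _ => ?_
    simp [hκi, mul_comm]
  have hseg : ∀ r : ℝ, inner ℝ v (E.symm ((r : ℂ), (0 : ℝ))) =
      inner ℝ v ((1 / 2 : ℝ) • (κ a + κ b)) + inner ℝ v ((1 / 2 : ℝ) • (κ b - κ a)) * r :=
    fun r => by
      rw [hEsymm, inner_add_right, inner_smul_right _ _ r, mul_comm r]
  have hzb : ∀ t, b ≤ t → 0 < 1 + (E (κ t)).2 := fun t _ => by linarith [hposz t]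
  refine encard_localMaxima_le (P := ∑ j, Polynomial.C (v j) * p j) hm ?_ (a := a) (b := b)
    (l := l) (u := inner ℝ v ((1 / 2 : ℝ) • (κ a + κ b)))
    (v := inner ℝ v ((1 / 2 : ℝ) • (κ b - κ a))) ?_ ?_ ?_ ?_ ?_ ?_ ?_ ?_ hab
  · exact Polynomial.natDegree_sum_le_of_forall_le _ _ fun j _ =>
      (Polynomial.natDegree_C_mul_le _ _).trans (hdeg j)
  · intro t ht
    rw [← hinner]
    exact congrArg _ (hkeq (hKarc t ht))
  · intro t ht
    rw [← hseg]
    exact congrArg _ (hkeq (hKr t ht))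
  · intro t ht
    rw [← hseg]
    exact congrArg _ (hkeq (hKl t ht))
  · have := hseg 0
    rw [mul_zero, add_zero] at this
    rw [← this]
    exact congrArg _ (hkeq hKi)
  · intro s hs t ht hst
    rw [hlb s hs, hlb t ht]
    exact inv_strictAnti₀ (hzb s hs) (by linarith [hmono' hs ht hst])
  · intro s hs t ht hst
    rw [hla s hs, hla t ht]
    refine neg_lt_neg (inv_strictAnti₀ (by linarith [hposz t]) ?_)
    linarith [hanti' hs ht hst]
  · intro t ht
    rw [hlb t ht]
    exact inv_pos.2 (hzb t ht)
  · intro t ht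
    rw [hla t ht]
    exact neg_neg_of_pos (inv_pos.2 (by linarith [hposz t]))

/-! ## Polynomials of odd degree -/

theorem Polynomial.tendsto_eval_atBot_of_odd {q : Polynomial ℝ} (ho : Odd q.natDegree)
    (hl : 0 < q.leadingCoeff) : Tendsto (fun t => q.eval t) atBot atBot := by
  have h := Polynomial.tendsto_eval_atTop (q := -(q.comp (-Polynomial.X)))
    (by rw [Polynomial.natDegree_neg, q.natDegree_comp_neg]; exact ho.pos)
    (by rw [Polynomial.leadingCoeff_neg, q.leadingCoeff_comp_neg, ho.neg_one_pow]; linarith)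
  have h2 := tendsto_neg_atTop_atBot.comp (h.comp tendsto_neg_atBot_atTop)
  simpa [Function.comp_def] using h2

/-- On any left half-line `q` is bounded above, and further right it increases to infinity, so
eventually it dominates all its earlier values. -/
theorem Polynomial.exists_le_eval_of_odd {q : Polynomial ℝ} (ho : Odd q.natDegree)
    (hl : 0 < q.leadingCoeff) : ∃ T : ℝ, ∀ t, T ≤ t → ∀ s ≤ t, q.eval s ≤ q.eval t := by
  obtain ⟨T₁, hT₁⟩ := Polynomial.exists_strictMonoOn_Ici ho.pos hl
  obtain ⟨S, hS⟩ := eventually_atBot.1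
    ((Polynomial.tendsto_eval_atBot_of_odd ho hl).eventually_le_atBot 0)
  obtain ⟨B, hB⟩ := (isCompact_Icc (a := S) (b := T₁)).exists_bound_of_continuousOn
    q.continuous.continuousOn
  obtain ⟨T, hTB, hT⟩ := (((Polynomial.tendsto_eval_atTop ho.pos hl).eventually_ge_atTop
    (max B 0)).and (eventually_ge_atTop T₁)).exists
  refine ⟨T, fun t ht s hst => ?_⟩
  rcases le_total T₁ s with h | h
  · exact hT₁.monotoneOn (Set.mem_Ici.2 h) (Set.mem_Ici.2 (hT.trans ht)) hst
  · have h1 : q.eval s ≤ max B 0 := by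
      rcases le_total s S with h' | h'
      · exact (hS s h').trans (le_max_right _ _)
      · exact ((le_abs_self _).trans (hB s ⟨h', h⟩)).trans (le_max_left _ _)
    exact (h1.trans hTB).trans
      (hT₁.monotoneOn (Set.mem_Ici.2 hT) (Set.mem_Ici.2 (hT.trans ht)) ht)

/-- Subtracting `c X`, with `c` half the leading coefficient, keeps the degree odd and the leading
coefficient positive, even in degree 1. The difference `y` dominates all earlier values near `+∞`
and, by reflection, lies below all later ones near `-∞`; so `p` grows at least as fast as `c X`. -/
theorem Polynomial.exists_growth_of_odd_of_pos {p : Polynomial ℝ} (ho : Odd p.natDegree)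
    (hl : 0 < p.leadingCoeff) :
    ∃ c T : ℝ, 0 < c ∧ ∀ t s : ℝ, T ≤ |t| → c * |t - s| ≤ |p.eval t - p.eval s| := by
  set c := p.leadingCoeff / 2 with hc
  have hc0 : 0 < c := half_pos hl
  set y := p - Polynomial.C c * Polynomial.X with hy
  have hyd : y.natDegree ≤ p.natDegree :=
    (Polynomial.natDegree_sub_le _ _).trans
      (max_le le_rfl ((Polynomial.natDegree_C_mul_le c _).trans
        (Polynomial.natDegree_X_le.trans ho.pos)))
  have hyc : 0 < y.coeff p.natDegree := by
    rw [hy, Polynomial.coeff_sub, Polynomial.coeff_C_mul, Polynomial.coeff_X,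
      Polynomial.coeff_natDegree]
    split_ifs <;> linarith
  have hyn : y.natDegree = p.natDegree :=
    Polynomial.natDegree_eq_of_le_of_coeff_ne_zero hyd hyc.ne'
  have hyl : 0 < y.leadingCoeff := by rwa [Polynomial.leadingCoeff, hyn]
  have hyo : Odd y.natDegree := hyn ▸ ho
  have hye : ∀ t, y.eval t = p.eval t - c * t := fun t => by simp [hy]
  obtain ⟨T, hT⟩ := Polynomial.exists_le_eval_of_odd hyo hyl
  obtain ⟨T', hT'⟩ := Polynomial.exists_le_eval_of_odd (q := -(y.comp (-Polynomial.X)))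
    (by rwa [Polynomial.natDegree_neg, y.natDegree_comp_neg])
    (by rw [Polynomial.leadingCoeff_neg, y.leadingCoeff_comp_neg, hyo.neg_one_pow]; linarith)
  simp only [Polynomial.eval_neg, Polynomial.eval_comp, Polynomial.eval_X, neg_le_neg_iff] at hT'
  have key : ∀ t s : ℝ, s ≤ t → (T ≤ t ∨ s ≤ -T') →
      c * |t - s| ≤ |p.eval t - p.eval s| := by
    intro t s hst h
    have h1 : y.eval s ≤ y.eval t := by
      rcases h with h | h
      · exact hT t h s hst
      · have := hT' (-s) (by linarith) (-t) (by linarith)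
        simpa using this
    rw [hye, hye] at h1
    rw [abs_of_nonneg (sub_nonneg.2 hst)]
    refine le_trans ?_ (le_abs_self _)
    linarith
  refine ⟨c, max T T', hc0, fun t s ht => ?_⟩
  have h1 : T ≤ |t| := (le_max_left _ _).trans ht
  have h2 : T' ≤ |t| := (le_max_right _ _).trans ht
  rcases le_total s t with hst | hst
  · refine key t s hst ?_
    rcases le_total 0 t with h | h
    · exact Or.inl (by rwa [abs_of_nonneg h] at h1)
    · rw [abs_of_nonpos h] at h2; exact Or.inr (by linarith)
  · rw [abs_sub_comm, abs_sub_comm (p.eval t)]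
    refine key s t hst ?_
    rcases le_total 0 t with h | h
    · rw [abs_of_nonneg h] at h1; exact Or.inl (by linarith)
    · rw [abs_of_nonpos h] at h2; exact Or.inr (by linarith)

theorem Polynomial.surjective_eval_of_odd_of_pos {p : Polynomial ℝ} (ho : Odd p.natDegree)
    (hl : 0 < p.leadingCoeff) : Function.Surjective fun t => p.eval t :=
  p.continuous.surjective (Polynomial.tendsto_eval_atTop ho.pos hl)
    (Polynomial.tendsto_eval_atBot_of_odd ho hl)

/-- A polynomial of odd degree is surjective, and grows at least linearly outside a compact set. -/
theorem Polynomial.exists_growth_of_odd {p : Polynomial ℝ} (ho : Odd p.natDegree) :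
    (Function.Surjective fun t => p.eval t) ∧
      ∃ c T : ℝ, 0 < c ∧ ∀ t s : ℝ, T ≤ |t| → c * |t - s| ≤ |p.eval t - p.eval s| := by
  have h0 : p.leadingCoeff ≠ 0 := by
    rw [Polynomial.leadingCoeff_ne_zero]
    rintro rfl
    simp at ho
  rcases lt_or_gt_of_ne h0 with h | h
  · have ho' : Odd (-p).natDegree := by rwa [Polynomial.natDegree_neg]
    have hl' : 0 < (-p).leadingCoeff := by rw [Polynomial.leadingCoeff_neg]; linarith
    refine ⟨fun y => ?_, ?_⟩
    · obtain ⟨t, ht⟩ := Polynomial.surjective_eval_of_odd_of_pos ho' hl' (-y)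
      exact ⟨t, by simpa using ht⟩
    · obtain ⟨c, T, hc, hT⟩ := Polynomial.exists_growth_of_odd_of_pos ho' hl'
      refine ⟨c, T, hc, fun t s hts => (hT t s hts).trans_eq ?_⟩
      rw [← abs_neg, Polynomial.eval_neg, Polynomial.eval_neg]
      congr 1; ring
  · exact ⟨Polynomial.surjective_eval_of_odd_of_pos ho h,
      Polynomial.exists_growth_of_odd_of_pos ho h⟩

/-- The difference quotient of a polynomial. -/
theorem Polynomial.exists_difference_quotient (p : Polynomial ℝ) :
    ∃ Q : ℝ × ℝ → ℝ, Continuous Q ∧ (∀ t s, p.eval t - p.eval s = (t - s) * Q (t, s)) ∧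
      ∀ t, Q (t, t) = p.derivative.eval t := by
  induction p using Polynomial.induction_on with
  | C a => exact ⟨fun _ => 0, continuous_const, by simp, by simp⟩
  | add p q hp hq =>
    obtain ⟨P, hP, h1, h2⟩ := hp
    obtain ⟨Q, hQ, h3, h4⟩ := hq
    refine ⟨fun x => P x + Q x, hP.add hQ, fun t s => ?_, fun t => ?_⟩
    · rw [Polynomial.eval_add, Polynomial.eval_add]
      linear_combination h1 t s + h3 t s
    · simp [h2, h4]
  | monomial n a hp =>
    obtain ⟨P, hP, h1, h2⟩ := hp
    rw [pow_succ, ← mul_assoc]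
    generalize Polynomial.C a * Polynomial.X ^ n = p at *
    -- From `t p(t) - s p(s) = (t - s) p(t) + s (p(t) - p(s))`.
    refine ⟨fun x => p.eval x.1 + x.2 * P x, by fun_prop, fun t s => ?_, fun t => ?_⟩
    · simp only [Polynomial.eval_mul, Polynomial.eval_X]
      linear_combination s * h1 t s
    · simp only [Polynomial.derivative_mul, Polynomial.derivative_X, Polynomial.eval_add,
        Polynomial.eval_mul, Polynomial.eval_X, h2]
      simp; ring

/-! ## Raising the degree of a polynomial knot of odd degree -/

/-- If a parameter is large, the growth of coordinate `i` suffices. On the remaining square the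
difference quotients never vanish simultaneously, by injectivity off the diagonal and immersivity on
it, so compactness bounds the sum of their absolute values below. -/
theorem PolynomialKnot.exists_antilipschitz {n : ℕ} (κ : PolynomialKnot n) {i : Fin n} {c T : ℝ}
    (hc : 0 < c)
    (hT : ∀ t s : ℝ, T ≤ |t| → c * |t - s| ≤ |(κ.coord i).eval t - (κ.coord i).eval s|) :
    ∃ L : ℝ, 0 ≤ L ∧ ∀ t s, |t - s| ≤ L * dist (κ.toFun t) (κ.toFun s) := by
  have hcoord : ∀ j t s, |(κ.coord j).eval t - (κ.coord j).eval s| ≤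
      dist (κ.toFun t) (κ.toFun s) := fun j t s => by
    rw [dist_eq_norm]
    exact PiLp.norm_apply_le (κ.toFun t - κ.toFun s) j
  choose Q hQc hQ hQd using fun j => (κ.coord j).exists_difference_quotient
  let q : ℝ × ℝ → ℝ := fun x => ∑ j, |Q j x|
  have hq0 : ∀ x, 0 < q x := by
    rintro ⟨t, s⟩
    obtain ⟨j, hj⟩ : ∃ j, Q j (t, s) ≠ 0 := by
      rcases eq_or_ne t s with rfl | hne
      · obtain ⟨j, hj⟩ := κ.immersive t
        exact ⟨j, by rwa [hQd]⟩
      · by_contra! h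
        exact hne (κ.injective t s fun j => by
          have := hQ j t s
          rw [h j, mul_zero] at this
          linarith)
    exact (abs_pos.2 hj).trans_le
      (Finset.single_le_sum (f := fun j => |Q j (t, s)|) (fun _ _ => abs_nonneg _)
        (Finset.mem_univ j))
  have hqc : Continuous q := by fun_prop
  obtain ⟨δ, hδ, hδq⟩ : ∃ δ, 0 < δ ∧ ∀ t s, |t| < T → |s| < T → δ ≤ q (t, s) := by
    rcases le_or_gt T 0 with h | h
    · exact ⟨1, one_pos, fun t _ ht => absurd ((abs_nonneg t).trans_lt ht) h.not_gt⟩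
    · obtain ⟨x, -, hx⟩ := ((isCompact_Icc (a := -T) (b := T)).prod
        (isCompact_Icc (a := -T) (b := T))).exists_isMinOn
        ⟨(0, 0), ⟨⟨by linarith, h.le⟩, by linarith, h.le⟩⟩ hqc.continuousOn
      exact ⟨q x, hq0 x, fun t s ht hs => hx ⟨abs_le.1 ht.le, abs_le.1 hs.le⟩⟩
  refine ⟨max (1 / c) (n / δ), le_max_of_le_left (by positivity), fun t s => ?_⟩
  have key : ∀ t s, T ≤ |t| → |t - s| ≤ 1 / c * dist (κ.toFun t) (κ.toFun s) := by
    intro t s ht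
    have := (hT t s ht).trans (hcoord i t s)
    rw [one_div_mul_eq_div, le_div_iff₀ hc]
    linarith
  have hd : 0 ≤ dist (κ.toFun t) (κ.toFun s) := dist_nonneg
  rcases le_or_gt T |t| with h1 | h1
  · exact (key t s h1).trans (mul_le_mul_of_nonneg_right (le_max_left _ _) hd)
  rcases le_or_gt T |s| with h2 | h2
  · rw [abs_sub_comm]
    refine (key s t h2).trans ?_
    rw [dist_comm]
    exact mul_le_mul_of_nonneg_right (le_max_left _ _) hd
  · refine le_trans ?_ (mul_le_mul_of_nonneg_right (le_max_right _ _) hd)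
    have h3 : |t - s| * q (t, s) ≤ n * dist (κ.toFun t) (κ.toFun s) := by
      rw [Finset.mul_sum]
      refine (Finset.sum_le_card_nsmul _ _ (dist (κ.toFun t) (κ.toFun s)) fun j _ => ?_).trans ?_
      · rw [← abs_mul, ← hQ]
        exact hcoord j t s
      · simp
    rw [div_mul_eq_mul_div, le_div_iff₀ hδ]
    exact (mul_le_mul_of_nonneg_left (hδq t s h1 h2) (abs_nonneg _)).trans h3

/-- McShane's extension theorem for a function given by a relation. -/
theorem exists_lipschitzWith_of_relation {E : Type*} [PseudoMetricSpace E] {R : E → ℝ → Prop}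
    {L : ℝ} (hL : 0 ≤ L) (h : ∀ x t x' t', R x t → R x' t' → |t - t'| ≤ L * dist x x') :
    ∃ f : E → ℝ, LipschitzWith L.toNNReal f ∧ ∀ x t, R x t → f x = t := by
  classical
  let f₀ : E → ℝ := fun x => if hx : ∃ t, R x t then hx.choose else 0
  have hf₀ : ∀ x, (∃ t, R x t) → R x (f₀ x) := fun x hx => by
    simp only [f₀, dif_pos hx]
    exact hx.choose_spec
  obtain ⟨f, hf, hff₀⟩ := LipschitzOnWith.extend_real (f := f₀) (s := {x | ∃ t, R x t})
    (K := L.toNNReal) (LipschitzOnWith.of_dist_le_mul fun x hx y hy => by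
      rw [Real.coe_toNNReal L hL, Real.dist_eq]
      exact h _ _ _ _ (hf₀ x hx) (hf₀ y hy))
  refine ⟨f, hf, fun x t hxt => ?_⟩
  rw [← hff₀ ⟨t, hxt⟩]
  -- At distance zero the estimate shows that `R` is single-valued.
  have := h _ _ _ _ (hf₀ x ⟨t, hxt⟩) hxt
  rw [dist_self, mul_zero] at this
  linarith [abs_nonpos_iff.1 this]

/-- A shear in a coordinate direction `j`, by a function that varies slowly in this direction. -/
theorem exists_shear {n : ℕ} {j : Fin n} {φ : Euc n → ℝ} (hφ : Continuous φ)
    (hj : ∀ x r, |φ (x + r • EuclideanSpace.single j (1 : ℝ)) - φ x| ≤ |r| / 2) :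
    ∃ g : OnePoint (Euc n) ≃ₜ OnePoint (Euc n), IsOrientationPreserving g ∧
      g OnePoint.infty = OnePoint.infty ∧
      ∀ x : Euc n, g x = (x + φ x • EuclideanSpace.single j (1 : ℝ) : Euc n) := by
  set e : Euc n := EuclideanSpace.single j (1 : ℝ) with he
  have hej : e j = 1 := by simp [he]
  have hek : ∀ k, k ≠ j → e k = 0 := fun k hk => by simp [he, hk]
  have hen : ‖e‖ = 1 := by simp [he]
  have hcoord : ∀ (x : Euc n) k, |x k| ≤ ‖x‖ := fun x k => PiLp.norm_apply_le x k
  let F : unitInterval → Euc n → Euc n := fun s x => x + ((s : ℝ) * φ x) • e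
  have key := exists_orientationPreserving_of_deformation F ?_ ?_ ?_ ?_
  · obtain ⟨g, hg, hgi, hgF⟩ := key
    refine ⟨g, hg, hgi, fun x => ?_⟩
    rw [hgF]
    simp [F]
  · fun_prop
  · intro R
    obtain ⟨B, hB⟩ := (isCompact_closedBall (0 : Euc n) (2 * R)).exists_bound_of_continuousOn
      hφ.continuousOn
    refine ⟨2 * R + 2 * (R + B), fun s x hx => ?_⟩
    -- The shear preserves the projection `x₀` along `e`. Since `|φ x| ≤ |x j| / 2 + B`, the
    -- coordinate obeys `|x j| ≤ R + |x j| / 2 + B`, whence `|x j| ≤ 2 (R + B)`.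
    set x₀ := x - x j • e with hx₀
    have h1 : x₀ = F s x - (F s x) j • e := by
      simp only [F, hx₀, PiLp.add_apply, PiLp.smul_apply, hej, smul_eq_mul, mul_one, add_smul]
      abel
    have h2 : |(F s x) j| ≤ R := (hcoord _ j).trans hx
    have h3 : ‖x₀‖ ≤ 2 * R := by
      rw [h1]
      refine (norm_sub_le _ _).trans ?_
      rw [norm_smul, hen, mul_one, Real.norm_eq_abs]
      linarith
    have h4 : |φ x₀| ≤ B := hB x₀ (mem_closedBall_zero_iff.2 h3)
    have h5 : |φ x - φ x₀| ≤ |x j| / 2 := by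
      have := hj x₀ (x j)
      rwa [show x₀ + x j • e = x by rw [hx₀]; abel] at this
    have h6 : |φ x| ≤ |x j| / 2 + B := by
      have := abs_sub_abs_le_abs_sub (φ x) (φ x₀)
      linarith
    have h7 : |(s : ℝ) * φ x| ≤ |φ x| := by
      rw [abs_mul, abs_of_nonneg s.2.1]
      exact mul_le_of_le_one_left (abs_nonneg _) s.2.2
    have h8 : (F s x) j = x j + s * φ x := by
      simp [F, hej]
    have h9 : |x j| ≤ |(F s x) j| + |(s : ℝ) * φ x| := by
      rw [h8]
      have := abs_sub (x j + s * φ x) (s * φ x)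
      simpa using this
    have h10 : x = x₀ + x j • e := by rw [hx₀]; abel
    have h11 : ‖x‖ ≤ ‖x₀‖ + |x j| := by
      conv_lhs => rw [h10]
      refine (norm_add_le _ _).trans ?_
      rw [norm_smul, hen, mul_one, Real.norm_eq_abs]
    linarith
  · intro x
    simp [F]
  · have hF1 : ∀ x, F 1 x = x + φ x • e := fun x => by simp [F]
    constructor
    · intro x y hxy
      rw [hF1, hF1] at hxy
      have h1 : y = x + (φ x - φ y) • e := by
        rw [sub_smul, ← add_sub_assoc, hxy]; abel
      have h2 := hj x (φ x - φ y)
      rw [← h1, abs_sub_comm] at h2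
      have h3 : φ x - φ y = 0 := abs_nonpos_iff.1 (by linarith [abs_nonneg (φ x - φ y)])
      rw [h1, h3, zero_smul, add_zero]
    · intro w
      have hc : Continuous fun r : ℝ => r + φ (w + r • e) := by fun_prop
      have hb : ∀ r, |φ (w + r • e) - φ w| ≤ |r| / 2 := fun r => hj w r
      have hs : Function.Surjective fun r : ℝ => r + φ (w + r • e) := by
        refine hc.surjective ?_ ?_
        · have ht : Tendsto (fun r : ℝ => r / 2 + φ w) atTop atTop :=
            tendsto_atTop_add_const_right _ _ (tendsto_id.atTop_div_const two_pos)
          refine tendsto_atTop_mono' _ ?_ ht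
          filter_upwards [eventually_ge_atTop 0] with r hr
          have := (abs_le.1 (hb r)).1
          rw [abs_of_nonneg hr] at this
          linarith
        · have ht : Tendsto (fun r : ℝ => r / 2 + φ w) atBot atBot :=
            tendsto_atBot_add_const_right _ _ (tendsto_id.atBot_div_const two_pos)
          refine tendsto_atBot_mono' _ ?_ ht
          filter_upwards [eventually_le_atBot 0] with r hr
          have := (abs_le.1 (hb r)).2
          rw [abs_of_nonpos hr] at this
          linarith
      obtain ⟨r, hr⟩ := hs 0
      refine ⟨w + r • e, ?_⟩
      rw [hF1, add_assoc, ← add_smul]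
      simp only at hr
      rw [hr, zero_smul, add_zero]

/-- A polynomial knot with a component `z` of odd degree: adding a small multiple of `t z(t)` to
another component does not change the knot type. -/
theorem PolynomialKnot.exists_raise_degree {n : ℕ} (κ : PolynomialKnot n) {i j : Fin n}
    (hij : i ≠ j) (ho : Odd (κ.coord i).natDegree) :
    ∃ (ε : ℝ) (g : OnePoint (Euc n) ≃ₜ OnePoint (Euc n)), ε ≠ 0 ∧ IsOrientationPreserving g ∧
      g OnePoint.infty = OnePoint.infty ∧
      ∀ t : ℝ, g (κ.toFun t) =
        (κ.toFun t + (ε * (t * (κ.coord i).eval t)) • EuclideanSpace.single j (1 : ℝ) : Euc n) := by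
  obtain ⟨hsurj, c, T, hc, hT⟩ := (κ.coord i).exists_growth_of_odd ho
  obtain ⟨L₁, hL₁, hκ⟩ := κ.exists_antilipschitz hc hT
  set L := max L₁ (1 / c) with hL
  have hL0 : 0 ≤ L := hL₁.trans (le_max_left _ _)
  have hcoord : ∀ x y : Euc n, |x i - y i| ≤ dist x y := fun x y => by
    rw [dist_eq_norm]
    exact PiLp.norm_apply_le (x - y) i
  -- Besides recovering the parameter on the curve, the second clause makes it depend on `x i` alone
  -- where `|x i|` is large, so that there the shear function is constant in direction `j`.
  let R : Euc n → ℝ → Prop := fun x t =>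
    x = κ.toFun t ∨ (T ≤ |t| ∧ x i = (κ.coord i).eval t)
  have hRi : ∀ x t, R x t → x i = (κ.coord i).eval t := by
    rintro x t (rfl | h)
    · rfl
    · exact h.2
  have htail : ∀ x t x' t', R x t → R x' t' → T ≤ |t| → |t - t'| ≤ L * dist x x' := by
    intro x t x' t' h h' ht
    have h1 := hT t t' ht
    rw [← hRi x t h, ← hRi x' t' h'] at h1
    have h2 := h1.trans (hcoord x x')
    refine le_trans ?_ (mul_le_mul_of_nonneg_right (le_max_right _ _) dist_nonneg)
    rw [one_div_mul_eq_div, le_div_iff₀ hc]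
    linarith
  obtain ⟨τ, hτ, hτR⟩ := exists_lipschitzWith_of_relation (R := R) hL0 (by
    intro x t x' t' h h'
    rcases h with h1 | h1
    · rcases h' with h2 | h2
      · rw [h1, h2]
        exact (hκ t t').trans (mul_le_mul_of_nonneg_right (le_max_left _ _) dist_nonneg)
      · rw [abs_sub_comm, dist_comm]
        exact htail x' t' x t (Or.inr h2) (Or.inl h1) h2.1
    · exact htail x t x' t' (Or.inr h1) h' h1.1)
  have hτd : ∀ x y, |τ x - τ y| ≤ L * dist x y := fun x y => by
    have := hτ.dist_le_mul x y
    rwa [Real.coe_toNNReal L hL0, Real.dist_eq] at this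
  obtain ⟨B, hB⟩ := (isCompact_Icc (a := -T) (b := T)).exists_bound_of_continuousOn
    (κ.coord i).continuous.continuousOn
  set Z := max B 0
  have hZ0 : 0 ≤ Z := le_max_right _ _
  have hZ : ∀ t, Z < |(κ.coord i).eval t| → T ≤ |t| := by
    intro t ht
    by_contra! h
    have := hB t (abs_le.1 h.le)
    rw [Real.norm_eq_abs] at this
    linarith [le_max_left B 0]
  -- Where `|x i| ≤ Z`, the function `τ x * x i` has Lipschitz constant at most `Z L` in direction
  -- `j`; this `ε` brings it to at most `1/2`. The `+ 1` avoids division by zero.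
  set ε := 1 / (2 * (Z * L + 1)) with hε
  have hZL : 0 ≤ Z * L := mul_nonneg hZ0 hL0
  have hε0 : 0 < ε := by positivity
  have hεL : ε * (Z * L) ≤ 1 / 2 := by
    rw [hε, one_div_mul_eq_div, div_le_div_iff₀ (by positivity) two_pos]
    linarith
  obtain ⟨g, hg, hgi, hgs⟩ := exists_shear (j := j) (φ := fun x => ε * (τ x * x i))
    (by have := hτ.continuous; fun_prop) (by
      intro x r
      have hxi : (x + r • EuclideanSpace.single j (1 : ℝ)) i = x i := by
        simp [hij]
      simp only [hxi]
      rcases le_or_gt |x i| Z with h | h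
      · have h1 := hτd (x + r • EuclideanSpace.single j (1 : ℝ)) x
        have h2 : dist (x + r • EuclideanSpace.single j (1 : ℝ)) x = |r| := by
          rw [dist_eq_norm, add_sub_cancel_left, norm_smul]
          simp
        rw [h2] at h1
        rw [← mul_sub, ← sub_mul, abs_mul, abs_mul, abs_of_pos hε0]
        have h3 := mul_le_mul h1 h (abs_nonneg _) (mul_nonneg hL0 (abs_nonneg r))
        calc _ ≤ ε * (L * |r| * Z) := mul_le_mul_of_nonneg_left h3 hε0.le
          _ = ε * (Z * L) * |r| := by ring
          _ ≤ 1 / 2 * |r| := mul_le_mul_of_nonneg_right hεL (abs_nonneg r)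
          _ = |r| / 2 := by ring
      · obtain ⟨t, ht⟩ := hsurj (x i)
        simp only at ht
        have htT : T ≤ |t| := hZ t (by rwa [ht])
        rw [hτR x t (Or.inr ⟨htT, ht.symm⟩), hτR _ t (Or.inr ⟨htT, hxi.trans ht.symm⟩), sub_self,
          abs_zero]
        positivity)
  refine ⟨ε, g, hε0.ne', hg, hgi, fun t => ?_⟩
  rw [hgs, hτR (κ.toFun t) t (Or.inl rfl)]
  rfl

/-- Every competitor for `β` is one for `α`, by composing with `g`; this inequality is the only one
needed. -/
theorem superbridgeNumber_le_of_map {α β : TopologicalKnot 3}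
    {g : OnePoint (Euc 3) ≃ₜ OnePoint (Euc 3)} (hg : IsOrientationPreserving g)
    (h : ∀ p, β.toMap p = g (α.toMap p)) : superbridgeNumber α ≤ superbridgeNumber β := by
  refine le_iInf₂ fun K hK => ?_
  obtain ⟨f, g', hf, hg', hK⟩ := hK
  exact iInf₂_le K ⟨f, g.trans g', hf, hg.trans hg', fun p => by rw [hK, h]; rfl⟩

theorem PolynomialKnot.superbridgeNumber_le_of_odd (κ : PolynomialKnot 3) {m : ℕ}
    (hdeg : ∀ j, (κ.coord j).natDegree ≤ 2 * m + 1) {i : Fin 3}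
    (hi : (κ.coord i).natDegree = 2 * m + 1) :
    superbridgeNumber κ.completion ≤ (m + 1 : ℕ) := by
  have hij : i ≠ i + 1 := by fin_cases i <;> decide
  obtain ⟨ε, g, hε, hg, hgi, hgκ⟩ := κ.exists_raise_degree hij ⟨m, hi⟩
  let β : TopologicalKnot 3 := ⟨(g : C(OnePoint (Euc 3), OnePoint (Euc 3))).comp κ.completion.toMap,
    g.injective.comp κ.completion.injective⟩
  refine (superbridgeNumber_le_of_map (β := β) hg fun p => rfl).trans ?_
  let q : Polynomial ℝ := Polynomial.C ε * (Polynomial.X * κ.coord i)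
  have hq : q.natDegree = 2 * (m + 1) := by
    have h0 : κ.coord i ≠ 0 := fun h => by simp [h] at hi
    rw [Polynomial.natDegree_C_mul hε, Polynomial.natDegree_X_mul h0, hi]
    ring
  refine superbridgeNumber_le_of_even (α := β)
    (p := fun j => if j = i + 1 then κ.coord j + q else κ.coord j) (fun t => ?_) ?_
    (Nat.le_add_left 1 m) (fun j => ?_) (i := i + 1) ?_
  · change g (κ.toFun t) = _
    rw [hgκ]
    congr 1
    ext j
    by_cases hj : j = i + 1
    · simp [hj, q, PolynomialKnot.toFun]
    · simp [hj, PolynomialKnot.toFun]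
  · exact hgi
  · have := hdeg j
    split_ifs
    · exact (Polynomial.natDegree_add_le _ _).trans (max_le (by omega) hq.le)
    · omega
  · have := hdeg (i + 1)
    rw [if_pos rfl, Polynomial.natDegree_add_eq_right_of_natDegree_lt (by omega), hq]

theorem PolynomialKnot.degree_pos {n : ℕ} (κ : PolynomialKnot n) : 0 < κ.degree := by
  obtain ⟨i, hi⟩ := κ.immersive 0
  refine lt_of_lt_of_le (Nat.pos_of_ne_zero fun h => hi ?_)
    (Finset.le_sup (f := fun i => (κ.coord i).natDegree) (Finset.mem_univ i))
  rw [Polynomial.derivative_of_natDegree_zero h, Polynomial.eval_zero]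

/-- A polynomial knot of degree `d` with superbridge number `s` (that of its one point
compactification) satisfies `s ≤ (1/2)(d+1)`; in particular its superbridge number is finite. -/
theorem mainTheorem8 (κ : PolynomialKnot 3) (d : ℕ) (hd : κ.degree = d) :
    ∃ s : ℕ, superbridgeNumber κ.completion = (s : ℕ∞) ∧ (s : ℝ) ≤ (1 / 2) * ((d : ℝ) + 1) := by
  obtain ⟨i, -, hi⟩ := Finset.exists_mem_eq_sup (Finset.univ : Finset (Fin 3))
    Finset.univ_nonempty fun i => (κ.coord i).natDegree
  have hid : (κ.coord i).natDegree = d := hi.symm.trans hd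
  have hle : ∀ j, (κ.coord j).natDegree ≤ d := fun j =>
    (Finset.le_sup (f := fun i => (κ.coord i).natDegree) (Finset.mem_univ j)).trans_eq hd
  have hpos : 0 < d := hd ▸ κ.degree_pos
  -- A natural number as upper bound yields finiteness along with the estimate.
  obtain ⟨b, hb, hbd⟩ : ∃ b : ℕ, superbridgeNumber κ.completion ≤ b ∧ 2 * b ≤ d + 1 := by
    rcases Nat.even_or_odd' d with ⟨m, hm | hm⟩
    · exact ⟨m, superbridgeNumber_le_of_even (p := κ.coord) (fun t => rfl) rfl (by omega)
        (fun j => hm ▸ hle j) (hid.trans hm), by omega⟩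
    · exact ⟨m + 1, κ.superbridgeNumber_le_of_odd (fun j => hm ▸ hle j) (hid.trans hm), by omega⟩
  obtain ⟨s, hs⟩ := ENat.ne_top_iff_exists.1 (ne_top_of_le_ne_top (ENat.natCast_ne_top b) hb)
  refine ⟨s, hs.symm, ?_⟩
  rw [← hs, Nat.cast_le] at hb
  have h : 2 * s ≤ d + 1 := by omega
  have h' : (2 : ℝ) * s ≤ d + 1 := by exact_mod_cast h
  linarith
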